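/- Let $\Gamma$ be a finite, connected, non-bipartite distance-regular graph with vertex set $X$, diameter $D\ge 3$, intersection numbers $p^h_{ij}$, $c_i=p^i_{1,i-1}$, $a_i=p^i_{1i}$, $b_i=p^i_{1,i+1}$, and eigenvalues $\theta_0>\theta_1>\dots>\theta_D$. Assume that $\Gamma$ has classical parameters $(D,1,\alpha,\beta)$ with $\alpha,\beta\in\mathbb R$, i.e. $c_i=i(1+\alpha(i-1))$ for $1\le i\le D$ and $b_i=(D-i)(\beta-\alpha i)$ for $0\le i\le D-1$, and that $\Gamma$ is tight, i.e. $$\Big(\theta_1+\frac{b_0}{a_1+1}\Big)\Big(\theta_D+\frac{b_0}{a_1+1}\Big)=-\frac{b_0a_1b_1}{(a_1+1)^2}.$$ Fix $x\in X$ and let $\partial$ be the path-length distance in $\Gamma$. Let $\Gamma_f$ be the graph on $X$ obtained from $\Gamma$ by deleting all edges $yz$ with $\partial(x,y)=\partial(x,z)$. Let $V=\mathbb C^X$, let $A$ be the adjacency matrix of $\Gamma$, let $E_i^*$ be the diagonal matrix with $(y,y)$-entry $1$ if $\partial(x,y)=i$ and $0$ otherwise, and put $L=\sum_{i=1}^{D}E^*_{i-1}AE^*_i$,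 $F=\sum_{i=0}^{D}E^*_iAE^*_i$, $R=\sum_{i=0}^{D-1}E^*_{i+1}AE^*_i$. Let $T$ be the algebra of complex matrices generated by $A,E_0^*,\dots,E_D^*$, and let $T_f$ be the algebra defined in the same way from $\Gamma_f$; it is generated by $L,R,E_0^*,\dots,E_D^*$. A $T$-module is a $T$-invariant subspace $W$ of $V$; it is irreducible if it is nonzero and contains no $T$-modules other than $0$ and $W$, its endpoint is $r=\min\{i: E_i^*W\ne0\}$, and it is thin if $\dim E_i^*W\le1$ for all $i$. A thin irreducible $T$-module has local eigenvalue $\eta$ if $F$ acts on $E_r^*W$ as $\eta$. For a real number $z\neq-1$ put $\tilde z=-1-b_1/(1+z)$; it is known that $\theta_1,\theta_D\neq-1$. (i) $\Gamma$ does not support a uniform structure with respect to $x$. That is, there are no tridiagonal complex matrix $U=(e_{ij})_{1\le i,j\le D}$ and no $f\in\mathbb C^D$ such that: $e_{ii}=1$ for all $i$; either $e_{i,i-1}\ne0$ for all $2\le i\le D$, or $e_{i-1,i}\neq0$ for all $2\le i\le D$; every principal submatrix $(e_{ij})_{s\le i,j\le t}$ with $1\le s\le t\le D$ is nonsingular;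 and, with $e_i^-=e_{i,i-1}$ for $2\le i\le D$, $e_i^+=e_{i,i+1}$ for $1\le i\le D-1$, $e_1^-=e_D^+=0$, $$e_i^-RL^2+LRL+e_i^+L^2R=f_iL\quad\text{on }E_i^*V\qquad(1\le i\le D).$$ (ii) There are irreducible $T$-modules $W$ and $W'$ with endpoint $1$, both thin, with local eigenvalues $\tilde\theta_1$ and $\tilde\theta_D$ respectively, such that every irreducible $T$-module with endpoint $1$ is isomorphic to $W$ or to $W'$ as a $T$-module, and $W$ and $W'$ are not isomorphic as $T_f$-modules. -/

import Mathlib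

namespace SimpleGraph

variable {X : Type*} [Fintype X] [DecidableEq X]

/-! ### Distance-regular graphs, classical parameters, tightness -/

/-- `G` is a (finite, connected) distance-regular graph with intersection numbers `p h i j`:
for all `h, i, j` in `{0, …, diam G}` and all vertices `y, z` at distance `h`, there are exactly
`p h i j` vertices at distance `i` from `y` and at distance `j` from `z`.
(The values of `p` outside this range are irrelevant.) -/
def IsDistanceRegularWith (G : SimpleGraph X) (p : ℕ → ℕ → ℕ → ℕ) : Prop :=
  G.Connected ∧ ∀ h i j : ℕ, h ≤ G.diam → i ≤ G.diam → j ≤ G.diam →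
    ∀ y z : X, G.dist y z = h →
      (Finset.univ.filter fun u : X => G.dist y u = i ∧ G.dist z u = j).card = p h i j

/-- The number `[j choose 1]_q = 1 + q + ⋯ + q ^ (j - 1)`. -/
noncomputable def qBracket (q : ℝ) (j : ℕ) : ℝ := ∑ l ∈ Finset.range j, q ^ l

/-- A distance-regular graph `G` with intersection numbers `p` has classical parameters
`(D, q, α, β)`; here `c i = p i 1 (i - 1)` and `b i = p i 1 (i + 1)`. -/
def HasClassicalParameters (G : SimpleGraph X) (p : ℕ → ℕ → ℕ → ℕ)
    (D : ℕ) (q α β : ℝ) : Prop :=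
  G.diam = D ∧
  (∀ i : ℕ, 1 ≤ i → i ≤ D →
    (p i 1 (i - 1) : ℝ) = qBracket q i * (1 + α * qBracket q (i - 1))) ∧
  (∀ i : ℕ, i < D →
    (p i 1 (i + 1) : ℝ) = (qBracket q D - qBracket q i) * (β - α * qBracket q i))

open scoped Classical in
/-- The set of eigenvalues of `G` (those of its adjacency matrix, which is real symmetric). -/
noncomputable def eigenvalueSet (G : SimpleGraph X) : Set ℝ := spectrum ℝ (G.adjMatrix ℝ)

/-- The second largest eigenvalue `θ₁`: the largest of the eigenvalues that are exceeded by some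
other eigenvalue. -/
noncomputable def secondEigenvalue (G : SimpleGraph X) : ℝ :=
  sSup {t | t ∈ G.eigenvalueSet ∧ ∃ s ∈ G.eigenvalueSet, t < s}

/-- The least eigenvalue, which is `θ_D` for a distance-regular graph of diameter `D`. -/
noncomputable def leastEigenvalue (G : SimpleGraph X) : ℝ := sInf G.eigenvalueSet

/-- A distance-regular graph `G` with intersection numbers `p` is tight when equality holds in the
fundamental bound; here `b₀ = p 0 1 1`, `a₁ = p 1 1 1`, `b₁ = p 1 1 2`. -/
def IsTight (G : SimpleGraph X) (p : ℕ → ℕ → ℕ → ℕ) : Prop :=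
  (G.secondEigenvalue + (p 0 1 1 : ℝ) / ((p 1 1 1 : ℝ) + 1)) *
      (G.leastEigenvalue + (p 0 1 1 : ℝ) / ((p 1 1 1 : ℝ) + 1)) =
    -((p 0 1 1 : ℝ) * (p 1 1 1 : ℝ) * (p 1 1 2 : ℝ)) / ((p 1 1 1 : ℝ) + 1) ^ 2

/-- The number `z̃ = -1 - b₁ / (1 + z)`, for `z ≠ -1`. It is used only for `z = θ₁` and `z = θ_D`,
which are different from `-1` in every distance-regular graph of diameter at least three. -/
noncomputable def tildeValue (p : ℕ → ℕ → ℕ → ℕ) (z : ℝ) : ℝ := -1 - (p 1 1 2 : ℝ) / (1 + z)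

/-! ### Dual idempotents, lowering, flat and raising matrices -/

/-- The eccentricity of the vertex `x` (for a finite connected graph). -/
noncomputable def vertexEcc (G : SimpleGraph X) (x : X) : ℕ :=
  Finset.univ.sup fun y : X => G.dist x y

open scoped Classical in
/-- The adjacency matrix with complex entries. -/
noncomputable def cAdj (G : SimpleGraph X) : Matrix X X ℂ := G.adjMatrix ℂ

/-- The `i`-th dual idempotent `E*_i` with respect to `x`
(the zero matrix if `i` exceeds the eccentricity of `x`). -/
noncomputable def dualIdempotent (G : SimpleGraph X) (x : X) (i : ℕ) : Matrix X X ℂ :=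
  Matrix.diagonal fun y => if G.dist x y = i then 1 else 0

/-- The lowering matrix with respect to `x`. -/
noncomputable def lowering (G : SimpleGraph X) (x : X) : Matrix X X ℂ :=
  ∑ i ∈ Finset.Icc 1 (G.vertexEcc x),
    G.dualIdempotent x (i - 1) * G.cAdj * G.dualIdempotent x i

/-- The flat matrix with respect to `x`. -/
noncomputable def flat (G : SimpleGraph X) (x : X) : Matrix X X ℂ :=
  ∑ i ∈ Finset.range (G.vertexEcc x + 1),
    G.dualIdempotent x i * G.cAdj * G.dualIdempotent x i

/-- The raising matrix with respect to `x`. -/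
noncomputable def raising (G : SimpleGraph X) (x : X) : Matrix X X ℂ :=
  ∑ i ∈ Finset.range (G.vertexEcc x),
    G.dualIdempotent x (i + 1) * G.cAdj * G.dualIdempotent x i

/-! ### Uniform structures -/

/-- `(U i j)`, `1 ≤ i, j ≤ ε`, is a parameter matrix. Only entries with indices in `{1, …, ε}`
are relevant. -/
structure IsParameterMatrix (ε : ℕ) (U : ℕ → ℕ → ℂ) : Prop where
  tridiagonal : ∀ i ∈ Finset.Icc 1 ε, ∀ j ∈ Finset.Icc 1 ε, (i + 1 < j ∨ j + 1 < i) → U i j = 0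
  diagonal : ∀ i ∈ Finset.Icc 1 ε, U i i = 1
  offDiagonal : (∀ i ∈ Finset.Icc 2 ε, U i (i - 1) ≠ 0) ∨ (∀ i ∈ Finset.Icc 2 ε, U (i - 1) i ≠ 0)
  nonsingular : ∀ s t : ℕ, 1 ≤ s → s ≤ t → t ≤ ε →
    (Matrix.of fun i j : Finset.Icc s t => U i j).det ≠ 0

/-- `e⁻_i = U i (i - 1)` for `2 ≤ i`, and `e⁻_1 = 0`. -/
noncomputable def eMinus (U : ℕ → ℕ → ℂ) (i : ℕ) : ℂ := if 2 ≤ i then U i (i - 1) else 0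

/-- `e⁺_i = U i (i + 1)` for `i < ε`, and `e⁺_ε = 0`. -/
noncomputable def ePlus (ε : ℕ) (U : ℕ → ℕ → ℂ) (i : ℕ) : ℂ := if i < ε then U i (i + 1) else 0

/-- `(U, f)` is a uniform structure of the bipartite graph `H` with respect to `x`: the matrix `U`
is a parameter matrix and `e⁻_i R L² + L R L + e⁺_i L² R = f_i L` holds on `E*_i V` for
`1 ≤ i ≤ ε`. An identity of matrices holds on `E*_i V` exactly when it holds after
multiplication by `E*_i` on the right. -/
def IsUniformStructure (H : SimpleGraph X) (x : X) (U : ℕ → ℕ → ℂ) (f : ℕ → ℂ) : Prop :=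
  IsParameterMatrix (H.vertexEcc x) U ∧
  ∀ i ∈ Finset.Icc 1 (H.vertexEcc x),
    (eMinus U i • (H.raising x * H.lowering x ^ 2)
        + H.lowering x * H.raising x * H.lowering x
        + ePlus (H.vertexEcc x) U i • (H.lowering x ^ 2 * H.raising x)) * H.dualIdempotent x i
      = (f i • H.lowering x) * H.dualIdempotent x i

/-- The graph `G_f` obtained from `G` by deleting all edges between vertices that are at the same
distance from `x`. -/
def flatFree (G : SimpleGraph X) (x : X) : SimpleGraph X where
  Adj y z := G.Adj y z ∧ G.dist x y ≠ G.dist x z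
  symm := ⟨fun _ _ h => ⟨h.1.symm, h.2.symm⟩⟩
  loopless := ⟨fun _ h => h.2 rfl⟩

/-- `G` supports a uniform structure with respect to `x`: the (bipartite) graph `G_f` admits one. -/
def SupportsUniformStructure (G : SimpleGraph X) (x : X) : Prop :=
  ∃ (U : ℕ → ℕ → ℂ) (f : ℕ → ℂ), (G.flatFree x).IsUniformStructure x U f

/-! ### The Terwilliger algebra and its modules -/

/-- The Terwilliger algebra `T(x)`, generated by the adjacency matrix and the dual idempotents.
The Terwilliger algebra `T_f` is the one of the graph `G_f`. -/
noncomputable def terwilligerAlgebra (G : SimpleGraph X) (x : X) : Subalgebra ℂ (Matrix X X ℂ) :=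
  Algebra.adjoin ℂ (insert G.cAdj (Set.range (G.dualIdempotent x)))

/-- A `T`-module is a subspace of the standard module that is invariant under `T`. -/
def IsTModule (T : Subalgebra ℂ (Matrix X X ℂ)) (W : Submodule ℂ (X → ℂ)) : Prop :=
  ∀ B ∈ T, ∀ w ∈ W, B.mulVec w ∈ W

/-- Irreducible `T`-modules. -/
def IsIrreducibleTModule (T : Subalgebra ℂ (Matrix X X ℂ)) (W : Submodule ℂ (X → ℂ)) : Prop :=
  IsTModule T W ∧ W ≠ ⊥ ∧ ∀ W' ≤ W, IsTModule T W' → W' = ⊥ ∨ W' = W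

/-- `W` and `W'` are isomorphic as `T`-modules: there is a linear bijection `σ : W → W'` with
`σ (B w) = B (σ w)` for all `B ∈ T` and `w ∈ W`. -/
def AreTIsomorphic (T : Subalgebra ℂ (Matrix X X ℂ)) (W W' : Submodule ℂ (X → ℂ)) : Prop :=
  ∃ σ : W ≃ₗ[ℂ] W', ∀ B ∈ T, ∀ w u : W,
    (u : X → ℂ) = B.mulVec (w : X → ℂ) → (σ u : X → ℂ) = B.mulVec (σ w : X → ℂ)

/-- The subspace `E*_i W`. -/
noncomputable def dualComponent (G : SimpleGraph X) (x : X) (i : ℕ) (W : Submodule ℂ (X → ℂ)) :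
    Submodule ℂ (X → ℂ) :=
  W.map (G.dualIdempotent x i).mulVecLin

/-- The endpoint of a nonzero `T`-module `W`: the least `i` with `E*_i W ≠ 0`. -/
noncomputable def endpoint (G : SimpleGraph X) (x : X) (W : Submodule ℂ (X → ℂ)) : ℕ :=
  sInf {i : ℕ | G.dualComponent x i W ≠ ⊥}

/-- `W` is thin: each `E*_i W` has dimension at most one. -/
def IsThin (G : SimpleGraph X) (x : X) (W : Submodule ℂ (X → ℂ)) : Prop :=
  ∀ i : ℕ, Module.finrank ℂ (G.dualComponent x i W) ≤ 1

/-- The thin module `W`, of endpoint `r`, has local eigenvalue `η`: the flat matrix acts on the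
line `E*_r W` as multiplication by `η`. -/
def HasLocalEigenvalue (G : SimpleGraph X) (x : X) (W : Submodule ℂ (X → ℂ)) (η : ℝ) : Prop :=
  G.IsThin x W ∧
  ∀ w ∈ G.dualComponent x (G.endpoint x W) W, (G.flat x).mulVec w = (η : ℂ) • w

end SimpleGraph

/-!
With base `1`, the eigenvalues and the standard sequences of `θ₁` and `θ_D = -D` are explicit, and
tightness forces `β = 1 + α (D - 1)`. Let `M₁`, `M_D` be the distance matrices with the standard
sequences as entries; they are multiples of the primitive idempotents of `θ₁` and `θ_D`. Tightness
makes the Gram matrices of the projections of the sum-zero vectors on the neighbourhood of `x` to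
the two eigenspaces orthogonal. Hence the compression of `M_D` to the neighbourhood maps all such
vectors into the kernel of `M₁`, and vice versa.

A sum-zero vector `v` on the neighbourhood which `M₁` or `M_D` annihilates satisfies a three-term
relation around each vertex `z`: its sums over the spheres of radius `∂(x, z) + 1` and `∂(x, z) - 1`
around `z` have a ratio that depends only on `∂(x, z)`. So the restrictions of these sums to the
spheres around `x` form a ladder on which `A` acts tridiagonally with explicit coefficients. The
ladder spans a thin irreducible module with endpoint one, determined up to isomorphism by the
coefficients, and each irreducible module with endpoint one arises in this way from one of the two
compressions.

Deleting the flat edges only removes the diagonal coefficients. What remains of the two ladders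
still differs in the eigenvalue of `LR` at the bottom. A `T_f`-isomorphism preserves this number,
and a uniform structure determines it, because the products of successive raising and lowering
coefficients solve a linear system whose matrix is a principal submatrix of `U`.
-/

namespace DistanceRegular

open SimpleGraph Finset Matrix

/-! ### Intersection arrays -/

section IntersectionArray

variable {X : Type*} {G : SimpleGraph X}

theorem dist_le_diam_of_connected [Finite X] (hG : G.Connected) (y z : X) :
    G.dist y z ≤ G.diam :=
  have := hG.nonempty
  dist_le_diam (connected_iff_ediam_ne_top.1 hG)

theorem dist_eq_or_of_adj {y w : X} (hyw : G.Adj y w) (z : X) :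
    G.dist w z + 1 = G.dist y z ∨ G.dist w z = G.dist y z ∨ G.dist w z = G.dist y z + 1 := by
  have h₁ := hyw.diff_dist_adj (u := z)
  have h₂ := hyw.symm.diff_dist_adj (u := z)
  rw [G.dist_comm (u := w), G.dist_comm (u := y)]
  lia

theorem exists_dist_add_dist_eq (hG : G.Connected) {y z : X} {i : ℕ} (hi : i ≤ G.dist y z) :
    ∃ w, G.dist y w = i ∧ G.dist w z + i = G.dist y z := by
  obtain ⟨q, hq⟩ := hG.exists_walk_length_eq_dist y z
  have htake := length_eq_dist_of_subwalk hq (q.isSubwalk_take i)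
  have hdrop := length_eq_dist_of_subwalk hq (q.isSubwalk_drop i)
  rw [Walk.take_length] at htake
  rw [Walk.drop_length] at hdrop
  exact ⟨q.getVert i, by lia, by lia⟩

variable [Fintype X]

open scoped Classical in
/-- `G` is connected and has the intersection numbers `c i`, `a i`, `b i`: a vertex `y` at distance
`i` from `z` has exactly `c i`, `a i`, `b i` neighbours at distance `i - 1`, `i`, `i + 1`
from `z`. -/
structure HasIntersectionArray (G : SimpleGraph X) (c a b : ℕ → ℕ) : Prop where
  connected : G.Connected
  card_c : ∀ y z, #{w ∈ G.neighborFinset y | G.dist w z + 1 = G.dist y z} = c (G.dist y z)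
  card_a : ∀ y z, #{w ∈ G.neighborFinset y | G.dist w z = G.dist y z} = a (G.dist y z)
  card_b : ∀ y z, #{w ∈ G.neighborFinset y | G.dist w z = G.dist y z + 1} = b (G.dist y z)

/-- The tridiagonal action of an intersection array on functions of the distance. -/
def arrayStep {R : Type*} [Semiring R] (c a b : ℕ → ℕ) (u : ℕ → R) (i : ℕ) : R :=
  c i * u (i - 1) + a i * u i + b i * u (i + 1)

/-- The numbers `c 0` and `b G.diam` are set to zero, because `p 0 1 (0 - 1)` and
`p d 1 (d + 1)` with `d = G.diam` are meaningless. -/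
theorem hasIntersectionArray_of_isDistanceRegularWith {p : ℕ → ℕ → ℕ → ℕ}
    (hG : G.IsDistanceRegularWith p) (hd : 1 ≤ G.diam) :
    HasIntersectionArray G (fun i => if i = 0 then 0 else p i 1 (i - 1)) (fun i => p i 1 i)
      (fun i => if i < G.diam then p i 1 (i + 1) else 0) := by
  classical
  obtain ⟨hconn, hp⟩ := hG
  have hle := dist_le_diam_of_connected hconn
  have card_eq : ∀ y z j, j ≤ G.diam →
      #{w ∈ G.neighborFinset y | G.dist w z = j} = p (G.dist y z) 1 j := by
    intro y z j hj
    rw [← hp _ 1 j (hle y z) hd hj y z rfl]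
    congr 1
    ext w
    simp [G.dist_comm (u := z)]
  refine ⟨hconn, fun y z => ?_, fun y z => card_eq y z _ (hle y z), fun y z => ?_⟩
  · split_ifs with h0
    · simp [h0]
    · rw [← card_eq y z _ ((Nat.sub_le _ _).trans (hle y z))]
      congr! 2 with w
      lia
  · split_ifs with h0
    · exact card_eq y z _ h0
    · refine card_eq_zero.2 (filter_eq_empty_iff.2 fun w _ hw => ?_)
      have := hle w z
      lia

namespace HasIntersectionArray

variable {c a b : ℕ → ℕ}

theorem sum_neighborFinset [DecidableRel G.Adj] (h : HasIntersectionArray G c a b) {R : Type*}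
    [Semiring R] (f : ℕ → R) (y z : X) :
    ∑ w ∈ G.neighborFinset y, f (G.dist w z) = arrayStep c a b f (G.dist y z) := by
  obtain rfl : ‹DecidableRel G.Adj› = fun _ _ => Classical.propDecidable _ := Subsingleton.elim _ _
  classical
  rw [arrayStep, ← h.card_c, ← h.card_a, ← h.card_b]
  simp only [card_filter, Nat.cast_sum, Finset.sum_mul, ← sum_add_distrib]
  refine sum_congr rfl fun w hw => ?_
  rcases dist_eq_or_of_adj ((G.mem_neighborFinset y w).1 hw) z with hd | hd | hd
  · simp [← hd, show ¬ G.dist w z = G.dist w z + 1 + 1 by lia]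
  · simp [hd]
  · simp [hd, show ¬ G.dist y z + 1 + 1 = G.dist y z by lia]

theorem c_zero (h : HasIntersectionArray G c a b) : c 0 = 0 := by
  obtain ⟨y⟩ := h.connected.nonempty
  simpa using (h.card_c y y).symm

theorem a_zero (h : HasIntersectionArray G c a b) : a 0 = 0 := by
  classical
  obtain ⟨y⟩ := h.connected.nonempty
  have hcard := h.card_a y y
  rw [dist_self] at hcard
  rw [← hcard, card_eq_zero, filter_eq_empty_iff]
  intro w hw hwy
  exact ((G.mem_neighborFinset y w).1 hw).ne (h.connected.dist_eq_zero_iff.1 hwy).symm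

theorem card_neighborFinset [DecidableRel G.Adj] (h : HasIntersectionArray G c a b) (y : X) :
    #(G.neighborFinset y) = b 0 := by
  simpa [arrayStep, h.c_zero, h.a_zero] using h.sum_neighborFinset (fun _ => (1 : ℕ)) y y

theorem exists_dist_eq_of_le_diam (h : HasIntersectionArray G c a b) {i : ℕ} (hi : i ≤ G.diam) :
    ∃ y z, G.dist y z = i := by
  have := h.connected.nonempty
  obtain ⟨y, z, hyz⟩ := G.exists_dist_eq_diam
  obtain ⟨w, hw, -⟩ := exists_dist_add_dist_eq h.connected (hyz ▸ hi)
  exact ⟨y, w, hw⟩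

theorem add_add_eq_b_zero (h : HasIntersectionArray G c a b) {i : ℕ} (hi : i ≤ G.diam) :
    c i + a i + b i = b 0 := by
  classical
  obtain ⟨y, z, rfl⟩ := h.exists_dist_eq_of_le_diam hi
  rw [← h.card_neighborFinset y]
  simpa [arrayStep] using (h.sum_neighborFinset (fun _ => (1 : ℕ)) y z).symm

theorem c_pos (h : HasIntersectionArray G c a b) {i : ℕ} (h0 : 1 ≤ i) (hi : i ≤ G.diam) :
    0 < c i := by
  obtain ⟨y, z, rfl⟩ := h.exists_dist_eq_of_le_diam hi
  obtain ⟨w, hyw, hw⟩ := exists_dist_add_dist_eq h.connected h0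
  rw [← h.card_c, card_pos]
  exact ⟨w, by simpa [hw] using hyw⟩

theorem b_pos (h : HasIntersectionArray G c a b) {i : ℕ} (hi : i < G.diam) : 0 < b i := by
  obtain ⟨w, z, hwz⟩ := h.exists_dist_eq_of_le_diam hi
  obtain ⟨y, hwy, hy⟩ := exists_dist_add_dist_eq h.connected (i := 1) (y := w) (z := z) (by lia)
  rw [show i = G.dist y z by lia, ← h.card_b, card_pos]
  exact ⟨w, by simpa [hy, G.adj_comm] using hwy⟩

theorem exists_dist_eq (h : HasIntersectionArray G c a b) (x : X) {i : ℕ} (hi : i ≤ G.diam) :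
    ∃ y, G.dist x y = i := by
  induction i with
  | zero => exact ⟨x, dist_self⟩
  | succ i ih =>
    obtain ⟨y, hy⟩ := ih (by lia)
    have hb := h.b_pos (i := i) (by lia)
    rw [← hy, G.dist_comm, ← h.card_b, card_pos] at hb
    obtain ⟨w, hw⟩ := hb
    exact ⟨w, by rw [G.dist_comm, (mem_filter.1 hw).2, G.dist_comm, hy]⟩

theorem vertexEcc_eq_diam (h : HasIntersectionArray G c a b) (x : X) : G.vertexEcc x = G.diam := by
  refine le_antisymm (Finset.sup_le fun y _ => dist_le_diam_of_connected h.connected x y) ?_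
  obtain ⟨y, hy⟩ := h.exists_dist_eq x le_rfl
  rw [← hy]
  exact le_sup (f := fun y => G.dist x y) (mem_univ y)

end HasIntersectionArray

end IntersectionArray

/-! ### Distance matrices -/

section DistMatrix

variable {X : Type*} {G : SimpleGraph X} {R : Type*}

/-- The matrix whose `(y, z)`-entry is `u` at the distance between `y` and `z`. -/
noncomputable def distMatrix (G : SimpleGraph X) (u : ℕ → R) : Matrix X X R :=
  Matrix.of fun y z => u (G.dist y z)

/-- The distance-`i` matrix of `G`. -/
noncomputable abbrev sphereMatrix (G : SimpleGraph X) (R : Type*) [Zero R] [One R] (i : ℕ) :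
    Matrix X X R :=
  distMatrix G (Pi.single i 1)

@[simp] theorem distMatrix_apply (u : ℕ → R) (y z : X) : distMatrix G u y z = u (G.dist y z) := rfl

theorem transpose_distMatrix (u : ℕ → R) : (distMatrix G u)ᵀ = distMatrix G u := by
  ext y z
  simp [G.dist_comm (u := y)]

theorem distMatrix_congr [Finite X] (hG : G.Connected) {u u' : ℕ → R}
    (hu : ∀ i ≤ G.diam, u i = u' i) : distMatrix G u = distMatrix G u' := by
  ext y z
  exact hu _ (dist_le_diam_of_connected hG y z)

theorem distMatrix_add [Add R] (u u' : ℕ → R) :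
    distMatrix G (u + u') = distMatrix G u + distMatrix G u' := rfl

theorem distMatrix_smul [Mul R] (r : R) (u : ℕ → R) :
    distMatrix G (r • u) = r • distMatrix G u := rfl

theorem sphereMatrix_zero [DecidableEq X] [Zero R] [One R] (hG : G.Connected) :
    sphereMatrix G R 0 = 1 := by
  ext y z
  simp [Matrix.one_apply, Pi.single_apply, hG.dist_eq_zero_iff]

theorem sphereMatrix_eq_zero [Finite X] [Zero R] [One R] (hG : G.Connected) {i : ℕ}
    (hi : G.diam < i) : sphereMatrix G R i = 0 :=
  distMatrix_congr (u' := 0) hG fun j hj => by simp [show j ≠ i by lia]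

theorem distMatrix_eq_sum_smul_sphereMatrix [Finite X] [Semiring R] (hG : G.Connected)
    (u : ℕ → R) : distMatrix G u = ∑ i ∈ range (G.diam + 1), u i • sphereMatrix G R i := by
  ext y z
  have := dist_le_diam_of_connected hG y z
  simp [Matrix.sum_apply, Pi.single_apply]
  lia

theorem arrayStep_single_succ [Semiring R] (c a b : ℕ → ℕ) (j : ℕ) :
    arrayStep c a b (Pi.single (j + 1) (1 : R)) = (b j : R) • Pi.single j 1 +
      (a (j + 1) : R) • Pi.single (j + 1) 1 + (c (j + 2) : R) • Pi.single (j + 2) 1 := by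
  ext i
  simp only [arrayStep, Pi.single_apply, Pi.add_apply, Pi.smul_apply, smul_eq_mul,
    show i - 1 = j + 1 ↔ i = j + 2 by lia, show i + 1 = j + 1 ↔ i = j by lia]
  split_ifs <;> subst_vars <;> first | lia | simp

/-- `u` is, in the range `i ≤ d`, an eigenvector for `θ` of the tridiagonal matrix of the
intersection array. Up to normalisation, it is the standard sequence of `θ`. -/
def IsStandardSequence [Semiring R] (c a b : ℕ → ℕ) (d : ℕ) (θ : R) (u : ℕ → R) : Prop :=
  ∀ i ≤ d, arrayStep c a b u i = θ * u i

variable [Fintype X] {c a b : ℕ → ℕ}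

theorem HasIntersectionArray.adjMatrix_mul_distMatrix [DecidableRel G.Adj] [Semiring R]
    (h : HasIntersectionArray G c a b) (u : ℕ → R) :
    G.adjMatrix R * distMatrix G u = distMatrix G (arrayStep c a b u) := by
  ext y z
  rw [adjMatrix_mul_apply]
  exact h.sum_neighborFinset u y z

theorem HasIntersectionArray.distMatrix_mul_adjMatrix [DecidableRel G.Adj] [CommSemiring R]
    (h : HasIntersectionArray G c a b) (u : ℕ → R) :
    distMatrix G u * G.adjMatrix R = distMatrix G (arrayStep c a b u) := by
  rw [← transpose_distMatrix (arrayStep c a b u), ← h.adjMatrix_mul_distMatrix,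
    Matrix.transpose_mul, transpose_distMatrix, transpose_adjMatrix]

theorem HasIntersectionArray.adjMatrix_mul_sphereMatrix_succ [DecidableRel G.Adj] [Semiring R]
    (h : HasIntersectionArray G c a b) (j : ℕ) :
    G.adjMatrix R * sphereMatrix G R (j + 1) = (b j : R) • sphereMatrix G R j +
      (a (j + 1) : R) • sphereMatrix G R (j + 1) + (c (j + 2) : R) • sphereMatrix G R (j + 2) := by
  rw [h.adjMatrix_mul_distMatrix, arrayStep_single_succ]
  rfl

namespace IsStandardSequence

theorem adjMatrix_mul_distMatrix [DecidableRel G.Adj] [Semiring R]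
    (h : HasIntersectionArray G c a b) {θ : R} {u : ℕ → R}
    (hu : IsStandardSequence c a b G.diam θ u) :
    G.adjMatrix R * distMatrix G u = θ • distMatrix G u := by
  rw [h.adjMatrix_mul_distMatrix]
  exact distMatrix_congr (u' := θ • u) h.connected hu

variable {K : Type*} [Field K] [CharZero K] {θ : K} {u : ℕ → K}

theorem exists_sphereMatrix_succ_mul_distMatrix_eq_smul (h : HasIntersectionArray G c a b)
    (hu : IsStandardSequence c a b G.diam θ u) {i : ℕ} {r s : K}
    (hr : sphereMatrix G K i * distMatrix G u = r • distMatrix G u)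
    (hs : sphereMatrix G K (i + 1) * distMatrix G u = s • distMatrix G u) :
    ∃ l : K, sphereMatrix G K (i + 2) * distMatrix G u = l • distMatrix G u := by
  classical
  rcases lt_or_ge G.diam (i + 2) with hd | hd
  · exact ⟨0, by rw [sphereMatrix_eq_zero h.connected hd, zero_mul, zero_smul]⟩
  refine ⟨(c (i + 2) : K)⁻¹ * (s * θ - b i * r - a (i + 1) * s), ?_⟩
  have hc : (c (i + 2) : K) ≠ 0 := Nat.cast_ne_zero.2 (h.c_pos (by lia) hd).ne'
  have hleft : G.adjMatrix K * sphereMatrix G K (i + 1) * distMatrix G u =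
      (s * θ) • distMatrix G u := by
    rw [h.adjMatrix_mul_distMatrix, ← h.distMatrix_mul_adjMatrix, Matrix.mul_assoc,
      hu.adjMatrix_mul_distMatrix h, Matrix.mul_smul, hs, smul_smul, mul_comm]
  rw [h.adjMatrix_mul_sphereMatrix_succ, Matrix.add_mul, Matrix.add_mul, Matrix.smul_mul,
    Matrix.smul_mul, Matrix.smul_mul, hr, hs] at hleft
  rw [mul_smul, eq_inv_smul_iff₀ hc]
  linear_combination (norm := module) hleft

theorem exists_sphereMatrix_mul_distMatrix_eq_smul (h : HasIntersectionArray G c a b)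
    (hu : IsStandardSequence c a b G.diam θ u) (i : ℕ) :
    ∃ l : K, sphereMatrix G K i * distMatrix G u = l • distMatrix G u := by
  classical
  induction i using Nat.twoStepInduction with
  | zero => exact ⟨1, by rw [sphereMatrix_zero h.connected, one_mul, one_smul]⟩
  | one =>
    refine ⟨θ, ?_⟩
    have hA : sphereMatrix G K 1 = G.adjMatrix K := by
      ext y z
      simp [Pi.single_apply, adjMatrix_apply]
    rw [hA, hu.adjMatrix_mul_distMatrix h]
  | more i hi hi' =>
    obtain ⟨r, hr⟩ := hi
    obtain ⟨s, hs⟩ := hi'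
    exact hu.exists_sphereMatrix_succ_mul_distMatrix_eq_smul h hr hs

theorem exists_distMatrix_mul_self_eq_smul (h : HasIntersectionArray G c a b)
    (hu : IsStandardSequence c a b G.diam θ u) :
    ∃ l : K, distMatrix G u * distMatrix G u = l • distMatrix G u := by
  choose l hl using hu.exists_sphereMatrix_mul_distMatrix_eq_smul h
  refine ⟨∑ i ∈ range (G.diam + 1), u i * l i, ?_⟩
  nth_rw 1 [distMatrix_eq_sum_smul_sphereMatrix h.connected u]
  simp only [Finset.sum_mul, Finset.sum_smul, Matrix.smul_mul, hl, smul_smul]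

end IsStandardSequence

end DistMatrix

/-! ### Graphs with classical parameters `(D, 1, α, β)` -/

section EigenvalueSet

variable {X : Type*} [Fintype X] [DecidableEq X] {G : SimpleGraph X} {c a b : ℕ → ℕ}

open scoped Classical in
theorem mem_eigenvalueSet_iff {t : ℝ} :
    t ∈ G.eigenvalueSet ↔ ∃ f : X → ℝ, f ≠ 0 ∧ G.adjMatrix ℝ *ᵥ f = t • f := by
  rw [eigenvalueSet, ← Matrix.spectrum_toLin', ← Module.End.hasEigenvalue_iff_mem_spectrum]
  constructor
  · intro h
    obtain ⟨f, hf⟩ := h.exists_hasEigenvector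
    exact ⟨f, hf.2, by simpa using hf.apply_eq_smul⟩
  · rintro ⟨f, hf, he⟩
    exact Module.End.hasEigenvalue_of_hasEigenvector (x := f)
      ⟨Module.End.mem_eigenspace_iff.2 (by simpa using he), hf⟩

theorem IsStandardSequence.mem_eigenvalueSet (h : HasIntersectionArray G c a b) {u : ℕ → ℝ} {θ : ℝ}
    (hu : IsStandardSequence c a b G.diam θ u) (h0 : u 0 ≠ 0) : θ ∈ G.eigenvalueSet := by
  classical
  obtain ⟨y⟩ := h.connected.nonempty
  refine mem_eigenvalueSet_iff.2 ⟨distMatrix G u *ᵥ Pi.single y 1, fun hy => h0 ?_, ?_⟩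
  · simpa using congrFun hy y
  · rw [mulVec_mulVec, hu.adjMatrix_mul_distMatrix h, smul_mulVec]

end EigenvalueSet

section UnitBase

/-- The candidates for the eigenvalues of a graph with classical parameters `(D, 1, α, β)`. -/
def theta (D : ℕ) (α β : ℝ) (j : ℕ) : ℝ := (D - j) * (β - α * j) - j

/-- The standard sequence of `theta D α β 1`, multiplied by `D * β`. -/
def secondSeq (D : ℕ) (α β : ℝ) (i : ℕ) : ℝ := D * β - (β + α * (D - 1) + 1) * i

/-- The standard sequence of the eigenvalue `-D`. -/
noncomputable def leastSeq (α β : ℝ) : ℕ → ℝ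
  | 0 => 1
  | i + 1 => -(1 + α * i) / (β - α * i) * leastSeq α β i

variable {X : Type*} [Fintype X]

/-- `G` has diameter `D ≥ 3` and the intersection array given by the classical parameters
`(D, 1, α, β)`. The requirement on `b D` is the convention `b D = 0`. -/
structure HasUnitBaseArray (G : SimpleGraph X) (D : ℕ) (α β : ℝ) (c a b : ℕ → ℕ) : Prop
    extends HasIntersectionArray G c a b where
  diam_eq : G.diam = D
  three_le : 3 ≤ D
  c_eq : ∀ i ≤ D, (c i : ℝ) = i * (1 + α * (i - 1))
  b_eq : ∀ i ≤ D, (b i : ℝ) = (D - i) * (β - α * i)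

variable {G : SimpleGraph X} {D : ℕ} {α β : ℝ} {c a b : ℕ → ℕ}

theorem exists_hasUnitBaseArray {p : ℕ → ℕ → ℕ → ℕ} (hG : G.IsDistanceRegularWith p)
    (hD : 3 ≤ D) (hcl : G.HasClassicalParameters p D 1 α β) :
    ∃ c a b, HasUnitBaseArray G D α β c a b ∧ b 0 = p 0 1 1 ∧ a 1 = p 1 1 1 ∧ b 1 = p 1 1 2 := by
  obtain ⟨rfl, hc, hb⟩ := hcl
  simp only [qBracket, one_pow, sum_const, card_range, nsmul_eq_mul, mul_one] at hc hb
  refine ⟨_, _, _, ⟨hasIntersectionArray_of_isDistanceRegularWith hG (by lia), rfl, hD,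
    fun i hi => ?_, fun i hi => ?_⟩, if_pos (by lia), rfl, if_pos (by lia)⟩
  · rcases Nat.eq_zero_or_pos i with rfl | h0
    · simp
    · rw [if_neg h0.ne', hc i h0 hi, Nat.cast_sub h0, Nat.cast_one]
  · rcases hi.lt_or_eq with h0 | rfl
    · rw [if_pos h0, hb i h0]
    · simp

theorem choose_succ_mul_add_one (i j : ℕ) :
    (i.choose (j + 1) : ℝ) * (j + 1) = i.choose j * (i - j) := by
  rcases le_or_gt j i with hj | hj
  · rw [← Nat.cast_sub hj]
    exact_mod_cast i.choose_succ_right_eq j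
  · rw [Nat.choose_eq_zero_of_lt hj, Nat.choose_eq_zero_of_lt (by lia)]
    simp

theorem mul_choose_succ_sub_choose_pred_succ (i j : ℕ) :
    (i : ℝ) * (i.choose (j + 1) - (i - 1).choose (j + 1)) = i.choose (j + 1) * (j + 1) := by
  rcases i with _ | i
  · simp
  · have hmul : ((i + 1 : ℕ) * i.choose j : ℝ) = (i + 1).choose (j + 1) * (j + 1 : ℕ) := by
      exact_mod_cast Nat.add_one_mul_choose_eq i j
    have hpascal : ((i + 1).choose (j + 1) : ℝ) = i.choose j + i.choose (j + 1) := by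
      exact_mod_cast Nat.choose_succ_succ' i j
    rw [Nat.add_sub_cancel]
    push_cast at hmul ⊢
    linear_combination hmul + (i + 1 : ℝ) * hpascal

theorem sum_neg_one_pow_mul_choose {D i : ℕ} (hi : i ≤ D) :
    ∑ j ∈ range (D + 1), (-1 : ℝ) ^ j * (i.choose j : ℝ) = if i = 0 then 1 else 0 := by
  have hsum : ∑ j ∈ range (i + 1), (-1 : ℝ) ^ j * (i.choose j : ℝ) = if i = 0 then 1 else 0 := by
    exact_mod_cast Int.alternating_sum_range_choose (n := i)
  rw [← hsum]
  refine (sum_subset (range_subset_range.2 (by lia)) fun j _ hj => ?_).symm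
  rw [Nat.choose_eq_zero_of_lt (by simpa using hj)]
  simp

theorem distMatrix_arrayStep_mulVec [DecidableRel G.Adj] (h : HasIntersectionArray G c a b)
    {t : ℝ} {f : X → ℝ} (hf : G.adjMatrix ℝ *ᵥ f = t • f) (u : ℕ → ℝ) :
    distMatrix G (arrayStep c a b u) *ᵥ f = t • distMatrix G u *ᵥ f := by
  rw [← h.distMatrix_mul_adjMatrix, ← mulVec_mulVec, hf, mulVec_smul]

namespace HasUnitBaseArray

theorem three_le_cast (h : HasUnitBaseArray G D α β c a b) : (3 : ℝ) ≤ D := by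
  exact_mod_cast h.three_le

theorem dist_le (h : HasUnitBaseArray G D α β c a b) (y z : X) : G.dist y z ≤ D :=
  h.diam_eq ▸ dist_le_diam_of_connected h.connected y z

theorem a_eq (h : HasUnitBaseArray G D α β c a b) {i : ℕ} (hi : i ≤ D) :
    (a i : ℝ) = D * β - i * (1 + α * (i - 1)) - (D - i) * (β - α * i) := by
  have hsum : (c i + a i + b i : ℝ) = b 0 := by
    exact_mod_cast h.add_add_eq_b_zero (h.diam_eq ▸ hi)
  rw [h.c_eq i hi, h.b_eq i hi, h.b_eq 0 (by lia)] at hsum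
  push_cast at hsum
  linear_combination hsum

theorem alpha_nonneg (h : HasUnitBaseArray G D α β c a b) : 0 ≤ α := by
  have hD := h.three_le
  have hc₂ := h.c_eq 2 (by lia)
  have hc₃ := h.c_eq 3 hD
  have hpos : (0 : ℝ) < c 3 := by exact_mod_cast h.c_pos (by lia) (h.diam_eq ▸ hD)
  push_cast at hc₂ hc₃
  -- `c 2 = 2 + 2 * α` is an integer, and it exceeds `1` because `c 3 = 3 + 6 * α` is positive
  have hlt : 1 < c 2 := by exact_mod_cast (by linarith : (1 : ℝ) < c 2)
  have hle : (2 : ℝ) ≤ c 2 := by exact_mod_cast hlt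
  linarith

theorem beta_sub_pos (h : HasUnitBaseArray G D α β c a b) {i : ℕ} (hi : i < D) :
    0 < β - α * i := by
  have hpos : (0 : ℝ) < b i := by exact_mod_cast h.b_pos (h.diam_eq ▸ hi)
  rw [h.b_eq i hi.le] at hpos
  exact pos_of_mul_pos_right hpos (sub_nonneg.2 (by exact_mod_cast hi.le))

theorem beta_pos (h : HasUnitBaseArray G D α β c a b) : 0 < β := by
  simpa using h.beta_sub_pos (i := 0) (by have := h.three_le; lia)

theorem beta_sub_diam_sub_one_pos (h : HasUnitBaseArray G D α β c a b) :
    0 < β - α * (D - 1) := by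
  have hD := h.three_le
  have := h.beta_sub_pos (i := D - 1) (by lia)
  rwa [Nat.cast_sub (by lia), Nat.cast_one] at this

theorem arrayStep_eq (h : HasUnitBaseArray G D α β c a b) (u : ℕ → ℝ) {i : ℕ} (hi : i ≤ D) :
    arrayStep c a b u i = D * β * u i - i * (1 + α * (i - 1)) * (u i - u (i - 1)) +
      (D - i) * (β - α * i) * (u (i + 1) - u i) := by
  rw [arrayStep, h.c_eq i hi, h.b_eq i hi, h.a_eq hi]
  ring

theorem isStandardSequence_one (h : HasUnitBaseArray G D α β c a b) :
    IsStandardSequence c a b G.diam (theta D α β 0) fun _ => 1 := by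
  intro i hi
  rw [h.arrayStep_eq _ (h.diam_eq ▸ hi), theta]
  simp

theorem isStandardSequence_secondSeq (h : HasUnitBaseArray G D α β c a b) :
    IsStandardSequence c a b G.diam (theta D α β 1) (secondSeq D α β) := by
  intro i hi
  rw [h.arrayStep_eq _ (h.diam_eq ▸ hi), theta]
  rcases i with _ | i <;> simp only [secondSeq, Nat.add_sub_cancel] <;> push_cast <;> ring

theorem sub_mul_leastSeq_succ (h : HasUnitBaseArray G D α β c a b) {i : ℕ} (hi : i < D) :
    (β - α * i) * leastSeq α β (i + 1) = -(1 + α * i) * leastSeq α β i := by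
  rw [leastSeq, ← mul_assoc, mul_div_cancel₀ _ (h.beta_sub_pos hi).ne']

theorem isStandardSequence_leastSeq (h : HasUnitBaseArray G D α β c a b) :
    IsStandardSequence c a b G.diam (-(D : ℝ)) (leastSeq α β) := by
  intro i hi
  rw [h.diam_eq] at hi
  have hup : (D - i) * (β - α * i) * leastSeq α β (i + 1) =
      (D - i) * (-(1 + α * i) * leastSeq α β i) := by
    rcases hi.lt_or_eq with hlt | rfl
    · rw [mul_assoc, h.sub_mul_leastSeq_succ hlt]
    · simp
  have hdown : i * (1 + α * (i - 1)) * leastSeq α β (i - 1) =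
      -(i * (β - α * (i - 1)) * leastSeq α β i) := by
    rcases i with _ | i
    · simp
    · have := h.sub_mul_leastSeq_succ (i := i) hi
      push_cast
      linear_combination (i + 1 : ℝ) * this
  rw [h.arrayStep_eq _ hi]
  linear_combination hup + hdown

theorem arrayStep_choose (h : HasUnitBaseArray G D α β c a b) (j : ℕ) {i : ℕ} (hi : i ≤ D) :
    arrayStep c a b (fun i => (i.choose (j + 1) : ℝ)) i =
      theta D α β (j + 1) * i.choose (j + 1) + (D - j) * (β - α * j) * i.choose j := by
  rw [h.arrayStep_eq _ hi, theta, Nat.choose_succ_succ' i j]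
  push_cast
  linear_combination -(1 + α * (i - 1)) * mul_choose_succ_sub_choose_pred_succ i j +
    (-(1 + α * (i - 1)) + (β + α * D + 1) - α * (j + 1)) * choose_succ_mul_add_one i j

theorem distMatrix_choose_mulVec_eq_zero [DecidableRel G.Adj] (h : HasUnitBaseArray G D α β c a b)
    {t : ℝ} {f : X → ℝ} (hf : G.adjMatrix ℝ *ᵥ f = t • f) (ht : ∀ j ≤ D, t ≠ theta D α β j) {j : ℕ}
    (hj : j ≤ D) :
    (distMatrix G fun i => (i.choose j : ℝ)) *ᵥ f = 0 := by
  have eq_zero {j : ℕ} (hj : j ≤ D) {w : X → ℝ} (hw : theta D α β j • w = t • w) : w = 0 := by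
    rw [← sub_eq_zero, ← sub_smul] at hw
    exact (smul_eq_zero.1 hw).resolve_left (sub_ne_zero.2 (ht j hj).symm)
  induction j with
  | zero =>
    refine eq_zero hj ?_
    have hstep : ∀ i ≤ G.diam, arrayStep c a b (fun i => (i.choose 0 : ℝ)) i =
        (theta D α β 0 • fun i : ℕ => (i.choose 0 : ℝ)) i := by
      simpa [IsStandardSequence] using h.isStandardSequence_one
    rw [← distMatrix_arrayStep_mulVec h.toHasIntersectionArray hf,
      distMatrix_congr h.connected hstep, distMatrix_smul, smul_mulVec]
  | succ j ih =>
    refine eq_zero hj ?_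
    have hstep : ∀ i ≤ G.diam, arrayStep c a b (fun i => (i.choose (j + 1) : ℝ)) i =
        (theta D α β (j + 1) • (fun i : ℕ => (i.choose (j + 1) : ℝ)) +
          ((D - j) * (β - α * j)) • fun i : ℕ => (i.choose j : ℝ)) i :=
      fun i hi => h.arrayStep_choose j (h.diam_eq ▸ hi)
    rw [← distMatrix_arrayStep_mulVec h.toHasIntersectionArray hf,
      distMatrix_congr h.connected hstep, distMatrix_add, distMatrix_smul, distMatrix_smul,
      add_mulVec, smul_mulVec, smul_mulVec, ih (by lia), smul_zero, add_zero]

theorem theta_le_theta_one (h : HasUnitBaseArray G D α β c a b) {j : ℕ} (h1 : 1 ≤ j)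
    (hj : j ≤ D) : theta D α β j ≤ theta D α β 1 := by
  have hα := h.alpha_nonneg
  have hβ := h.beta_sub_diam_sub_one_pos
  have h1' : (0 : ℝ) ≤ j - 1 := sub_nonneg.2 (by exact_mod_cast h1)
  have hj' : (0 : ℝ) ≤ D - j := sub_nonneg.2 (by exact_mod_cast hj)
  have hD : (0 : ℝ) ≤ D - 2 := by linarith [h.three_le_cast]
  have hdiff : theta D α β 1 - theta D α β j =
      (j - 1) * (1 + (β - α * (D - 1)) + α * (D - j) + α * (D - 2)) := by
    simp only [theta]
    push_cast
    ring
  rw [← sub_nonneg, hdiff]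
  positivity

theorem theta_one_lt_theta_zero (h : HasUnitBaseArray G D α β c a b) :
    theta D α β 1 < theta D α β 0 := by
  have hα := h.alpha_nonneg
  have hβ := h.beta_sub_diam_sub_one_pos
  have hD : (0 : ℝ) ≤ D - 1 := by linarith [h.three_le_cast]
  have hdiff : theta D α β 0 - theta D α β 1 = 1 + (β - α * (D - 1)) + 2 * α * (D - 1) := by
    simp only [theta]
    push_cast
    ring
  rw [← sub_pos, hdiff]
  positivity

theorem neg_diam_le_theta (h : HasUnitBaseArray G D α β c a b) {j : ℕ} (hj : j ≤ D) :
    -(D : ℝ) ≤ theta D α β j := by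
  rcases hj.lt_or_eq with hlt | rfl
  · have hβ := h.beta_sub_pos hlt
    have hj' : (0 : ℝ) ≤ D - j := sub_nonneg.2 (by exact_mod_cast hj)
    have : 0 ≤ (D - j) * (β - α * j + 1) := by positivity
    simp only [theta]
    linarith
  · simp [theta]

theorem isBipartite_of_a_eq_zero (h : HasUnitBaseArray G D α β c a b) (ha : ∀ i ≤ D, a i = 0) :
    G.IsBipartite := by
  classical
  obtain ⟨x⟩ := h.connected.nonempty
  refine ⟨Coloring.mk (fun y => (⟨G.dist y x % 2, Nat.mod_lt _ two_pos⟩ : Fin 2)) ?_⟩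
  intro y w hyw hparity
  replace hparity : G.dist y x % 2 = G.dist w x % 2 := congrArg Fin.val hparity
  have hdist : G.dist w x = G.dist y x := by
    have := dist_eq_or_of_adj hyw x
    lia
  have hcard := ha _ (h.dist_le y x)
  rw [← h.card_a, card_eq_zero, filter_eq_empty_iff] at hcard
  exact hcard ((G.mem_neighborFinset y w).2 hyw) hdist

theorem alpha_pos (h : HasUnitBaseArray G D α β c a b) (hβ : β = 1 + α * (D - 1))
    (hb : ¬ G.IsBipartite) : 0 < α := by
  refine lt_of_le_of_ne h.alpha_nonneg fun h0 => hb (h.isBipartite_of_a_eq_zero fun i hi => ?_)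
  have ha := h.a_eq hi
  rw [hβ, ← h0] at ha
  ring_nf at ha
  exact_mod_cast ha

variable [DecidableEq X]

/-- The array acts on the binomial sequences `i ↦ i.choose j` by a triangular matrix with diagonal
entries `theta D α β j`, so only these can be eigenvalues. -/
theorem exists_eq_theta_of_mem_eigenvalueSet (h : HasUnitBaseArray G D α β c a b) {t : ℝ}
    (ht : t ∈ G.eigenvalueSet) : ∃ j ≤ D, t = theta D α β j := by
  classical
  by_contra! hne
  obtain ⟨f, hf, hAf⟩ := mem_eigenvalueSet_iff.1 ht
  have hone : (1 : Matrix X X ℝ) =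
      ∑ j ∈ range (D + 1), (-1 : ℝ) ^ j • distMatrix G (fun i => (i.choose j : ℝ)) := by
    rw [← sphereMatrix_zero h.connected]
    ext y z
    simp [Matrix.sum_apply, sum_neg_one_pow_mul_choose (h.dist_le y z), Pi.single_apply]
  apply hf
  rw [← one_mulVec f, hone, sum_mulVec]
  refine sum_eq_zero fun j hj => ?_
  rw [smul_mulVec, h.distMatrix_choose_mulVec_eq_zero hAf hne (by simpa [Nat.lt_succ_iff] using hj),
    smul_zero]

theorem secondEigenvalue_eq (h : HasUnitBaseArray G D α β c a b) :
    G.secondEigenvalue = theta D α β 1 := by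
  have hsecond : secondSeq D α β 0 ≠ 0 := by
    have hβ := h.beta_pos
    have hD := h.three_le_cast
    simp only [secondSeq, Nat.cast_zero, mul_zero, sub_zero]
    positivity
  refine IsGreatest.csSup_eq ⟨⟨h.isStandardSequence_secondSeq.mem_eigenvalueSet h.1 hsecond, _,
    h.isStandardSequence_one.mem_eigenvalueSet h.1 one_ne_zero, h.theta_one_lt_theta_zero⟩, ?_⟩
  rintro t ⟨ht, s, hs, hts⟩
  obtain ⟨j, hj, rfl⟩ := h.exists_eq_theta_of_mem_eigenvalueSet ht
  obtain ⟨i, hi, rfl⟩ := h.exists_eq_theta_of_mem_eigenvalueSet hs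
  rcases Nat.eq_zero_or_pos j with rfl | hj0
  · rcases Nat.eq_zero_or_pos i with rfl | hi0
    · exact absurd hts (lt_irrefl _)
    · exact absurd (hts.trans_le (h.theta_le_theta_one hi0 hi)) h.theta_one_lt_theta_zero.not_gt
  · exact h.theta_le_theta_one hj0 hj

theorem leastEigenvalue_eq (h : HasUnitBaseArray G D α β c a b) : G.leastEigenvalue = -D := by
  refine IsLeast.csInf_eq
    ⟨h.isStandardSequence_leastSeq.mem_eigenvalueSet h.1 (by simp [leastSeq]), fun t ht => ?_⟩
  obtain ⟨j, hj, rfl⟩ := h.exists_eq_theta_of_mem_eigenvalueSet ht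
  exact h.neg_diam_le_theta hj

theorem beta_eq_of_tight (h : HasUnitBaseArray G D α β c a b)
    (ht : (G.secondEigenvalue + (b 0 : ℝ) / ((a 1 : ℝ) + 1)) *
      (G.leastEigenvalue + (b 0 : ℝ) / ((a 1 : ℝ) + 1)) =
        -((b 0 : ℝ) * (a 1 : ℝ) * (b 1 : ℝ)) / ((a 1 : ℝ) + 1) ^ 2) :
    β = 1 + α * (D - 1) := by
  have hD := h.three_le
  have hD' := h.three_le_cast
  have hβ := h.beta_pos
  have hα := h.alpha_nonneg
  have hβ₁ := h.beta_sub_pos (i := 1) (by lia)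
  have ha : (a 1 : ℝ) = β + α * (D - 1) - 1 := by
    rw [h.a_eq (by lia)]
    push_cast
    ring
  have hpos₁ : (0 : ℝ) < D - 1 := by linarith
  have hpos : 0 < β + α * (D - 1) := by positivity
  rw [h.secondEigenvalue_eq, h.leastEigenvalue_eq, ha, h.b_eq 0 (by lia), h.b_eq 1 (by lia),
    theta, sub_add_cancel] at ht
  push_cast at ht hβ₁
  field_simp at ht
  have hne : D * (D - 1) * (β - α * 1) * (β + α * (D - 1)) ≠ 0 := by positivity
  rw [← sub_eq_zero]
  refine (mul_eq_zero.1 ?_).resolve_left hne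
  linear_combination ht

end HasUnitBaseArray

end UnitBase

/-! ### Local vectors -/

section LocalProjection

variable {X : Type*} {G : SimpleGraph X} {c a b : ℕ → ℕ}

/-- The complex version of `distMatrix` for real sequences. -/
noncomputable abbrev cDistMatrix (G : SimpleGraph X) (u : ℕ → ℝ) : Matrix X X ℂ :=
  distMatrix G fun i => (u i : ℂ)

theorem isHermitian_cDistMatrix (u : ℕ → ℝ) : (cDistMatrix G u).IsHermitian := by
  ext y z
  simp [G.dist_comm (u := y)]

/-- The characteristic vector of the neighbourhood of `x`. -/
noncomputable def neighborVec (G : SimpleGraph X) (x : X) : X → ℂ :=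
  fun y => if G.dist x y = 1 then 1 else 0

/-- The orthogonal projection onto the functions on the neighbourhood of `x` with sum zero, when
`k` is the degree of `x`. -/
noncomputable def localProj [DecidableEq X] (G : SimpleGraph X) (x : X) (k : ℕ) : Matrix X X ℂ :=
  diagonal (neighborVec G x) - (k : ℂ)⁻¹ • vecMulVec (neighborVec G x) (neighborVec G x)

theorem isHermitian_localProj [DecidableEq X] (x : X) (k : ℕ) : (localProj G x k).IsHermitian := by
  have hstar : star (neighborVec G x) = neighborVec G x := by
    ext y
    classical simp [neighborVec, apply_ite]
  simp [IsHermitian, localProj, conjTranspose_sub, conjTranspose_smul, diagonal_conjTranspose,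
    conjTranspose_vecMulVec, hstar]

variable [Fintype X]

open scoped ComplexOrder in
theorem mul_mul_eq_zero_of_trace_eq_zero {M M' E : Matrix X X ℂ} (hM : M.IsHermitian)
    (hM' : M'.IsHermitian) (hE : E.IsHermitian) {l l' : ℂ} (hl : M * M = l • M)
    (hl' : M' * M' = l' • M') (htr : (E * M * E * M').trace = 0) : M * E * M' = 0 := by
  have hgram : (M * E * M')ᴴ * (M * E * M') = l • (M' * (E * M * E * M')) := by
    calc (M * E * M')ᴴ * (M * E * M') = M' * E * (M * M) * E * M' := by
          simp only [conjTranspose_mul, hM.eq, hM'.eq, hE.eq, Matrix.mul_assoc]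
      _ = l • (M' * (E * M * E * M')) := by
          simp only [hl, Matrix.mul_smul, Matrix.smul_mul, Matrix.mul_assoc]
  rw [← trace_conjTranspose_mul_self_eq_zero_iff, hgram, trace_smul, trace_mul_comm,
    Matrix.mul_assoc, hl', Matrix.mul_smul, trace_smul, htr, smul_zero, smul_zero]

theorem arrayStep_ofReal (c a b : ℕ → ℕ) (u : ℕ → ℝ) (i : ℕ) :
    arrayStep c a b (fun i => (u i : ℂ)) i = arrayStep c a b u i := by
  simp [arrayStep]

theorem IsStandardSequence.ofReal {d : ℕ} {θ : ℝ} {u : ℕ → ℝ}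
    (hu : IsStandardSequence c a b d θ u) :
    IsStandardSequence c a b d (θ : ℂ) fun i => (u i : ℂ) := fun i hi => by
  rw [arrayStep_ofReal, hu i hi, Complex.ofReal_mul]

theorem neighborVec_dotProduct [DecidableRel G.Adj] (x : X) (f : X → ℂ) :
    neighborVec G x ⬝ᵥ f = ∑ y ∈ G.neighborFinset x, f y := by
  simp [neighborVec, dotProduct, ← sum_filter, neighborFinset_eq_filter]

theorem trace_vecMulVec_neighborVec_mul (x : X) (M : Matrix X X ℂ) :
    (vecMulVec (neighborVec G x) (neighborVec G x) * M).trace =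
      neighborVec G x ⬝ᵥ M *ᵥ neighborVec G x := by
  rw [trace_mul_comm, mul_vecMulVec, trace_vecMulVec, dotProduct_comm]

namespace HasIntersectionArray

theorem cDistMatrix_mulVec_neighborVec_apply (h : HasIntersectionArray G c a b) (u : ℕ → ℝ)
    {x y : X} (hy : G.dist x y = 1) :
    (cDistMatrix G u *ᵥ neighborVec G x) y = arrayStep c a b u 1 := by
  classical
  have hsum := h.sum_neighborFinset (fun i => (u i : ℂ)) x y
  rw [hy, arrayStep_ofReal] at hsum
  rw [mulVec, dotProduct_comm, neighborVec_dotProduct, ← hsum]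
  exact sum_congr rfl fun z _ => by simp only [distMatrix_apply, G.dist_comm]

theorem neighborVec_dotProduct_cDistMatrix_mulVec (h : HasIntersectionArray G c a b)
    (u : ℕ → ℝ) (x : X) : neighborVec G x ⬝ᵥ cDistMatrix G u *ᵥ neighborVec G x =
      b 0 * arrayStep c a b u 1 := by
  classical
  rw [neighborVec_dotProduct, sum_congr rfl fun y hy =>
    h.cDistMatrix_mulVec_neighborVec_apply u (dist_eq_one_iff_adj.2 (by simpa using hy))]
  simp [h.card_neighborFinset]

theorem vecMulVec_mul_cDistMatrix_mul_vecMulVec (h : HasIntersectionArray G c a b) (u : ℕ → ℝ)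
    (x : X) : vecMulVec (neighborVec G x) (neighborVec G x) *
      (cDistMatrix G u * vecMulVec (neighborVec G x) (neighborVec G x)) =
        (b 0 * (arrayStep c a b u 1 : ℝ) : ℂ) • vecMulVec (neighborVec G x) (neighborVec G x) := by
  rw [mul_vecMulVec, vecMulVec_mul_vecMulVec, h.neighborVec_dotProduct_cDistMatrix_mulVec,
    vecMulVec_smul]

variable [DecidableEq X]

theorem diagonal_neighborVec_mul_cDistMatrix_mul (h : HasIntersectionArray G c a b) (u : ℕ → ℝ)
    (x : X) : diagonal (neighborVec G x) *
      (cDistMatrix G u * vecMulVec (neighborVec G x) (neighborVec G x)) =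
        ((arrayStep c a b u 1 : ℝ) : ℂ) • vecMulVec (neighborVec G x) (neighborVec G x) := by
  rw [mul_vecMulVec, mul_vecMulVec, ← smul_vecMulVec]
  congr 1
  ext y
  rw [mulVec_diagonal]
  by_cases hy : G.dist x y = 1
  · rw [h.cDistMatrix_mulVec_neighborVec_apply u hy]
    simp [neighborVec, hy]
  · simp [neighborVec, hy]

theorem vecMulVec_mul_cDistMatrix_mul_diagonal (h : HasIntersectionArray G c a b) (u : ℕ → ℝ)
    (x : X) : vecMulVec (neighborVec G x) (neighborVec G x) *
      (cDistMatrix G u * diagonal (neighborVec G x)) =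
        ((arrayStep c a b u 1 : ℝ) : ℂ) • vecMulVec (neighborVec G x) (neighborVec G x) := by
  simpa [transpose_mul, transpose_distMatrix, Matrix.mul_assoc, transpose_vecMulVec] using
    congrArg transpose (h.diagonal_neighborVec_mul_cDistMatrix_mul u x)

end HasIntersectionArray

variable [DecidableEq X]

theorem trace_diagonal_neighborVec_mul (x : X) (u u' : ℕ → ℝ) :
    (diagonal (neighborVec G x) * (cDistMatrix G u * diagonal (neighborVec G x)) *
      cDistMatrix G u').trace =
        neighborVec G x ⬝ᵥ cDistMatrix G (fun i => u i * u' i) *ᵥ neighborVec G x := by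
  simp only [trace, diag_apply, dotProduct, mulVec, Finset.mul_sum]
  refine sum_congr rfl fun y _ => ?_
  rw [Matrix.mul_apply]
  refine sum_congr rfl fun z _ => ?_
  rw [diagonal_mul, mul_diagonal]
  simp only [distMatrix_apply, G.dist_comm (u := z)]
  push_cast
  ring

namespace HasIntersectionArray

theorem localProj_mul_cDistMatrix_mul_localProj (h : HasIntersectionArray G c a b) (hb : b 0 ≠ 0)
    (u : ℕ → ℝ) (x : X) : localProj G x (b 0) * cDistMatrix G u * localProj G x (b 0) =
      diagonal (neighborVec G x) * (cDistMatrix G u * diagonal (neighborVec G x)) -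
        ((b 0 : ℂ)⁻¹ * arrayStep c a b u 1) • vecMulVec (neighborVec G x) (neighborVec G x) := by
  have hk : (b 0 : ℂ) ≠ 0 := by exact_mod_cast hb
  rw [Matrix.mul_assoc]
  simp only [localProj, Matrix.mul_sub, Matrix.sub_mul, Matrix.mul_smul, Matrix.smul_mul,
    h.diagonal_neighborVec_mul_cDistMatrix_mul, h.vecMulVec_mul_cDistMatrix_mul_diagonal,
    h.vecMulVec_mul_cDistMatrix_mul_vecMulVec, smul_smul]
  rw [inv_mul_cancel_left₀ hk, sub_self, smul_zero, sub_zero]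

theorem trace_localProj_mul (h : HasIntersectionArray G c a b) (hb : b 0 ≠ 0) (u u' : ℕ → ℝ)
    (x : X) :
    (localProj G x (b 0) * cDistMatrix G u * localProj G x (b 0) * cDistMatrix G u').trace =
      b 0 * arrayStep c a b (fun i => u i * u' i) 1 -
        arrayStep c a b u 1 * arrayStep c a b u' 1 := by
  have hk : (b 0 : ℂ) ≠ 0 := by exact_mod_cast hb
  rw [h.localProj_mul_cDistMatrix_mul_localProj hb, Matrix.sub_mul, trace_sub, Matrix.smul_mul,
    trace_smul, trace_diagonal_neighborVec_mul, trace_vecMulVec_neighborVec_mul,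
    h.neighborVec_dotProduct_cDistMatrix_mulVec, h.neighborVec_dotProduct_cDistMatrix_mulVec,
    smul_eq_mul]
  field_simp

/-- The trace condition says that the Gram matrices of the projections of the local vectors to the
two eigenspaces are orthogonal. Being positive semidefinite, they then have product zero. -/
theorem cDistMatrix_mul_localProj_mul_eq_zero (h : HasIntersectionArray G c a b) (hb : b 0 ≠ 0)
    {u u' : ℕ → ℝ} {θ θ' : ℝ} (hu : IsStandardSequence c a b G.diam θ u)
    (hu' : IsStandardSequence c a b G.diam θ' u')
    (htr : b 0 * arrayStep c a b (fun i => u i * u' i) 1 =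
      arrayStep c a b u 1 * arrayStep c a b u' 1) (x : X) :
    cDistMatrix G u * localProj G x (b 0) * cDistMatrix G u' = 0 := by
  obtain ⟨l, hl⟩ := hu.ofReal.exists_distMatrix_mul_self_eq_smul h
  obtain ⟨l', hl'⟩ := hu'.ofReal.exists_distMatrix_mul_self_eq_smul h
  refine mul_mul_eq_zero_of_trace_eq_zero (isHermitian_cDistMatrix u) (isHermitian_cDistMatrix u')
    (isHermitian_localProj x _) hl hl' ?_
  rw [h.trace_localProj_mul hb, sub_eq_zero]
  exact_mod_cast htr

end HasIntersectionArray

end LocalProjection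

section LocalVector

variable {X : Type*} {G : SimpleGraph X}

theorem cAdj_eq_cDistMatrix : cAdj G = cDistMatrix G (Pi.single 1 1) := by
  classical
  ext y z
  simp [cAdj, adjMatrix_apply, Pi.single_apply, apply_ite]

variable [Fintype X]

/-- `v` is supported on the neighbourhood of `x` and its entries have sum zero. -/
structure IsLocalVector (G : SimpleGraph X) (x : X) (v : X → ℂ) : Prop where
  support : ∀ y, G.dist x y ≠ 1 → v y = 0
  sum_eq : ∑ y, v y = 0

variable {c a b : ℕ → ℕ} {x : X} {v : X → ℂ}

theorem IsLocalVector.neighborVec_dotProduct_cDistMatrix_mulVec (hv : IsLocalVector G x v)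
    (h : HasIntersectionArray G c a b) (u : ℕ → ℝ) :
    neighborVec G x ⬝ᵥ cDistMatrix G u *ᵥ v = 0 := by
  rw [dotProduct_mulVec, ← mulVec_transpose, transpose_distMatrix]
  calc (cDistMatrix G u *ᵥ neighborVec G x) ⬝ᵥ v = ∑ y, ((arrayStep c a b u 1 : ℝ) : ℂ) * v y := by
        refine sum_congr rfl fun y _ => ?_
        by_cases hy : G.dist x y = 1
        · rw [h.cDistMatrix_mulVec_neighborVec_apply u hy]
        · rw [hv.support y hy, mul_zero, mul_zero]
    _ = 0 := by rw [← Finset.mul_sum, hv.sum_eq, mul_zero]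

variable [DecidableEq X]

theorem dualIdempotent_mulVec_apply (x : X) (i : ℕ) (f : X → ℂ) (y : X) :
    (dualIdempotent G x i *ᵥ f) y = if G.dist x y = i then f y else 0 := by
  simp [dualIdempotent, mulVec_diagonal]

/-- The compression of `cDistMatrix G u` to the neighbourhood of `x`, applied to `v`. -/
noncomputable def localAction (G : SimpleGraph X) (x : X) (u : ℕ → ℝ) (v : X → ℂ) : X → ℂ :=
  dualIdempotent G x 1 *ᵥ (cDistMatrix G u *ᵥ v)

theorem localAction_apply (u : ℕ → ℝ) (y : X) :
    localAction G x u v y = if G.dist x y = 1 then (cDistMatrix G u *ᵥ v) y else 0 :=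
  dualIdempotent_mulVec_apply x 1 _ y

namespace IsLocalVector

theorem isLocalVector_localAction (hv : IsLocalVector G x v) (h : HasIntersectionArray G c a b)
    (u : ℕ → ℝ) : IsLocalVector G x (localAction G x u v) where
  support y hy := by rw [localAction_apply, if_neg hy]
  sum_eq := by
    rw [← hv.neighborVec_dotProduct_cDistMatrix_mulVec h u]
    refine sum_congr rfl fun y _ => ?_
    rw [localAction_apply, neighborVec, ite_mul, one_mul, zero_mul]

theorem cDistMatrix_mulVec_localAction_eq_zero (hv : IsLocalVector G x v)
    (h : HasIntersectionArray G c a b) (hb : b 0 ≠ 0) {u u' : ℕ → ℝ} {θ θ' : ℝ}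
    (hu : IsStandardSequence c a b G.diam θ u) (hu' : IsStandardSequence c a b G.diam θ' u')
    (htr : b 0 * arrayStep c a b (fun i => u i * u' i) 1 =
      arrayStep c a b u 1 * arrayStep c a b u' 1) :
    cDistMatrix G u *ᵥ localAction G x u' v = 0 := by
  have hproj : localProj G x (b 0) *ᵥ (cDistMatrix G u' *ᵥ v) = localAction G x u' v := by
    rw [localProj, sub_mulVec, smul_mulVec, vecMulVec_mulVec,
      hv.neighborVec_dotProduct_cDistMatrix_mulVec h]
    simp only [localAction, smul_zero, sub_zero, MulOpposite.op_zero, zero_smul]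
    rfl
  rw [← hproj, mulVec_mulVec, mulVec_mulVec,
    h.cDistMatrix_mul_localProj_mul_eq_zero hb hu hu' htr, zero_mulVec]

/-- Two neighbours of `x` are at distance at most two, so on local vectors the distance matrices
reduce to the identity, the local adjacency matrix and an all-one matrix, which acts as zero. -/
theorem localAction_eq (hv : IsLocalVector G x v) (hG : G.Connected) (u : ℕ → ℝ) :
    localAction G x u v = (u 0 - u 2 : ℂ) • v +
      (u 1 - u 2 : ℂ) • dualIdempotent G x 1 *ᵥ (cAdj G *ᵥ v) := by
  ext y
  simp only [localAction_apply, dualIdempotent_mulVec_apply, Pi.add_apply, Pi.smul_apply]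
  by_cases hy : G.dist x y = 1
  swap
  · simp [hy, hv.support y hy]
  have hself : v y = ∑ z, if G.dist y z = 0 then v z else 0 := by
    simp [hG.dist_eq_zero_iff]
  have hsum : ∑ z, (u 2 : ℂ) * v z = 0 := by rw [← Finset.mul_sum, hv.sum_eq, mul_zero]
  rw [if_pos hy, if_pos hy, hself, cAdj_eq_cDistMatrix, ← sub_eq_zero]
  refine Eq.trans ?_ hsum
  simp only [mulVec, dotProduct, distMatrix_apply, smul_eq_mul, Finset.mul_sum,
    ← sum_add_distrib, ← sum_sub_distrib]
  refine sum_congr rfl fun z _ => ?_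
  by_cases hz : G.dist x z = 1
  · have htri := hG.dist_triangle (u := y) (v := x) (w := z)
    rw [G.dist_comm (u := y) (v := x), hy, hz] at htri
    rcases (by lia : G.dist y z = 0 ∨ G.dist y z = 1 ∨ G.dist y z = 2) with hd | hd | hd <;>
      simp [hd] <;> ring
  · simp [hv.support z hz]

end IsLocalVector

end LocalVector

/-! ### Ladders -/

section Ladder

variable {X : Type*} [Fintype X] {G : SimpleGraph X} {x : X} {v : X → ℂ} {c a b : ℕ → ℕ}

/-- The sums of `v` over the spheres of radius `i`. -/
noncomputable def sphereSum (G : SimpleGraph X) (v : X → ℂ) (i : ℕ) : X → ℂ :=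
  sphereMatrix G ℂ i *ᵥ v

/-- Around every vertex `z` at distance `i ≥ 1` from `x`, the sum of `v` over the sphere of radius
`i + 1` is `q i` times the sum over the sphere of radius `i - 1`. -/
def HasSphereRatio (G : SimpleGraph X) (x : X) (v : X → ℂ) (q : ℕ → ℝ) : Prop :=
  ∀ z i, G.dist x z = i + 1 → sphereSum G v (i + 2) z = q (i + 1) * sphereSum G v i z

theorem sphereSum_eq_zero_of_diam_lt (hG : G.Connected) {i : ℕ} (hi : G.diam < i) :
    sphereSum G v i = 0 := by
  rw [sphereSum, sphereMatrix_eq_zero hG hi, zero_mulVec]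

theorem HasIntersectionArray.cAdj_mulVec_sphereSum_succ (h : HasIntersectionArray G c a b)
    (i : ℕ) : cAdj G *ᵥ sphereSum G v (i + 1) = (b i : ℂ) • sphereSum G v i +
      (a (i + 1) : ℂ) • sphereSum G v (i + 1) + (c (i + 2) : ℂ) • sphereSum G v (i + 2) := by
  classical
  simp only [sphereSum, mulVec_mulVec, cAdj, h.adjMatrix_mul_sphereMatrix_succ, add_mulVec,
    smul_mulVec]

theorem HasIntersectionArray.cAdj_mulVec_sphereSum_zero (h : HasIntersectionArray G c a b) :
    cAdj G *ᵥ sphereSum G v 0 = (a 0 : ℂ) • sphereSum G v 0 + (c 1 : ℂ) • sphereSum G v 1 := by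
  have hstep : arrayStep c a b (Pi.single 0 (1 : ℂ)) =
      (a 0 : ℂ) • Pi.single 0 1 + (c 1 : ℂ) • Pi.single 1 1 := by
    ext i
    rcases i with _ | _ | i <;> simp [arrayStep, h.c_zero]
  classical
  simp only [sphereSum, mulVec_mulVec, cAdj, h.adjMatrix_mul_distMatrix, hstep, distMatrix_add,
    distMatrix_smul, add_mulVec, smul_mulVec]

theorem cAdj_mulVec_apply_eq_zero {w : X → ℂ} {r : ℕ} (hw : ∀ y, G.dist x y ≠ r → w y = 0)
    {z : X} (hz : G.dist x z + 1 < r ∨ r + 1 < G.dist x z) : (cAdj G *ᵥ w) z = 0 := by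
  rw [cAdj, adjMatrix_mulVec_apply]
  refine sum_eq_zero fun y hy => hw y ?_
  have := dist_eq_or_of_adj (by simpa using hy : G.Adj z y) x
  rw [G.dist_comm (u := y), G.dist_comm (u := z)] at this
  lia

namespace IsLocalVector

theorem cDistMatrix_mulVec_apply (hv : IsLocalVector G x v) (hG : G.Connected) (u : ℕ → ℝ) {z : X}
    {i : ℕ} (hz : G.dist x z = i + 1) :
    (cDistMatrix G u *ᵥ v) z = u i * sphereSum G v i z + u (i + 1) * sphereSum G v (i + 1) z +
      u (i + 2) * sphereSum G v (i + 2) z := by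
  simp only [sphereSum, mulVec, dotProduct, Finset.mul_sum, ← sum_add_distrib, distMatrix_apply]
  refine sum_congr rfl fun y _ => ?_
  by_cases hy : G.dist x y = 1
  · have h₁ := hG.dist_triangle (u := z) (v := x) (w := y)
    have h₂ := hG.dist_triangle (u := x) (v := y) (w := z)
    rw [G.dist_comm (u := z) (v := x)] at h₁
    rw [G.dist_comm (u := y) (v := z)] at h₂
    rcases (by lia : G.dist z y = i ∨ G.dist z y = i + 1 ∨ G.dist z y = i + 2) with e | e | e <;>
      simp [e]
  · simp [hv.support y hy]

theorem sphereSum_apply_eq_zero (hv : IsLocalVector G x v) (hG : G.Connected) {z : X} {j : ℕ}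
    (hz : G.dist x z + 1 < j ∨ j + 1 < G.dist x z) : sphereSum G v j z = 0 := by
  refine sum_eq_zero fun y _ => ?_
  by_cases hy : G.dist x y = 1
  · have h₁ := hG.dist_triangle (u := z) (v := x) (w := y)
    have h₂ := hG.dist_triangle (u := x) (v := y) (w := z)
    rw [G.dist_comm (u := z) (v := x)] at h₁
    rw [G.dist_comm (u := y) (v := z)] at h₂
    simp [show G.dist z y ≠ j by lia]
  · rw [hv.support y hy, mul_zero]

theorem sphereSum_self (hv : IsLocalVector G x v) (j : ℕ) : sphereSum G v j x = 0 := by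
  have hterm : ∀ y, sphereMatrix G ℂ j x y * v y = (Pi.single j 1 : ℕ → ℂ) 1 * v y := fun y => by
    by_cases hy : G.dist x y = 1
    · simp [hy]
    · rw [hv.support y hy, mul_zero, mul_zero]
  rw [sphereSum, mulVec, dotProduct, sum_congr rfl fun y _ => hterm y, ← Finset.mul_sum,
    hv.sum_eq, mul_zero]

theorem sphereSum_add (hv : IsLocalVector G x v) (hG : G.Connected) {z : X} {i : ℕ}
    (hz : G.dist x z = i + 1) :
    sphereSum G v i z + sphereSum G v (i + 1) z + sphereSum G v (i + 2) z = 0 := by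
  have hone := hv.cDistMatrix_mulVec_apply hG (fun _ => 1) hz
  have hsum : (cDistMatrix G (fun _ => 1) *ᵥ v) z = 0 := by
    rw [← hv.sum_eq]
    simp [mulVec, dotProduct]
  rw [hsum] at hone
  push_cast at hone
  linear_combination -hone

theorem gap_mul_sphereSum (hv : IsLocalVector G x v) (hG : G.Connected) {u : ℕ → ℝ}
    (hu : cDistMatrix G u *ᵥ v = 0) {z : X} {i : ℕ} (hz : G.dist x z = i + 1) :
    (u i - u (i + 1)) * sphereSum G v i z = (u (i + 1) - u (i + 2)) * sphereSum G v (i + 2) z := by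
  have hker := hv.cDistMatrix_mulVec_apply hG u hz
  rw [hu, Pi.zero_apply] at hker
  linear_combination -hker - (u (i + 1) : ℂ) * hv.sphereSum_add hG hz

theorem sphereSum_apply_eq_zero_of_dist_eq_diam (hv : IsLocalVector G x v) (hG : G.Connected)
    {u : ℕ → ℝ} (hu : cDistMatrix G u *ᵥ v = 0) (hgap : ∀ i < G.diam, u i ≠ u (i + 1)) {z : X}
    {i : ℕ} (hz : G.dist x z = i + 1) (hi : i + 1 = G.diam) : sphereSum G v i z = 0 := by
  have hrel := hv.gap_mul_sphereSum hG hu hz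
  rw [sphereSum_eq_zero_of_diam_lt hG (by lia : G.diam < i + 2), Pi.zero_apply, mul_zero] at hrel
  exact (mul_eq_zero.1 hrel).resolve_left (sub_ne_zero.2 (by exact_mod_cast hgap i (by lia)))

theorem hasSphereRatio (hv : IsLocalVector G x v) (hG : G.Connected) {u q : ℕ → ℝ}
    (hu : cDistMatrix G u *ᵥ v = 0) (hgap : ∀ i < G.diam, u i ≠ u (i + 1))
    (hq : ∀ i, i + 1 < G.diam → q (i + 1) * (u (i + 1) - u (i + 2)) = u i - u (i + 1)) :
    HasSphereRatio G x v q := by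
  intro z i hz
  rcases (hz ▸ dist_le_diam_of_connected hG x z : i + 1 ≤ G.diam).lt_or_eq with hi | hi
  · have hrel := hv.gap_mul_sphereSum hG hu hz
    have hratio : ((q (i + 1) : ℂ)) * (u (i + 1) - u (i + 2)) = u i - u (i + 1) := by
      exact_mod_cast hq i hi
    have hne : (u (i + 1) - u (i + 2) : ℂ) ≠ 0 :=
      sub_ne_zero.2 (by exact_mod_cast hgap (i + 1) hi)
    apply mul_left_cancel₀ hne
    linear_combination -hrel - sphereSum G v i z * hratio
  · rw [sphereSum_eq_zero_of_diam_lt hG (by lia),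
      hv.sphereSum_apply_eq_zero_of_dist_eq_diam hG hu hgap hz hi, Pi.zero_apply, mul_zero]

theorem sphereSum_succ_apply (hv : IsLocalVector G x v) (hG : G.Connected) {q : ℕ → ℝ}
    (hq : HasSphereRatio G x v q) {z : X} {i : ℕ} (hz : G.dist x z = i + 1) :
    sphereSum G v (i + 1) z = (-1 - q (i + 1)) * sphereSum G v i z := by
  linear_combination hv.sphereSum_add hG hz - hq z i hz

end IsLocalVector

theorem HasIntersectionArray.cAdj_mulVec_sphereSum_apply (h : HasIntersectionArray G c a b)
    (hv : IsLocalVector G x v) {r : ℕ} {z : X} (hz : r < G.dist x z) :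
    (cAdj G *ᵥ sphereSum G v r) z =
      a r * sphereSum G v r z + c (r + 1) * sphereSum G v (r + 1) z := by
  rcases r with _ | r
  · rw [h.cAdj_mulVec_sphereSum_zero]
    rfl
  · rw [h.cAdj_mulVec_sphereSum_succ]
    have hzero := hv.sphereSum_apply_eq_zero h.connected (j := r) (z := z) (by lia)
    simp [hzero]

/-- The flat coefficients of the ladder of a local vector with sphere ratios `q`. -/
def flatCoeff (c a : ℕ → ℕ) (q : ℕ → ℝ) (r : ℕ) : ℝ :=
  a (r - 1) + c r * (-1 - q r) - c (r - 1) * (-1 - q (r - 1))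

/-- The lowering coefficients of the ladder of a local vector with sphere ratios `q`. Only the
values at `r ≥ 2` are meaningful. -/
def downCoeff (c a b : ℕ → ℕ) (q : ℕ → ℝ) (r : ℕ) : ℝ :=
  b (r - 2) + a (r - 1) * (-1 - q (r - 1)) + c r * q (r - 1) -
    (-1 - q (r - 1)) * flatCoeff c a q (r - 1) - q (r - 2) * c (r - 2)

theorem sphereSum_zero (hG : G.Connected) : sphereSum G v 0 = v := by
  classical
  rw [sphereSum, sphereMatrix_zero hG, one_mulVec]

variable [DecidableEq X]

/-- The part on the sphere of radius `r` around `x` of the sums of `v` over spheres of radius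
`r - 1`. -/
noncomputable def ladderVec (G : SimpleGraph X) (x : X) (v : X → ℂ) : ℕ → X → ℂ
  | 0 => 0
  | r + 1 => dualIdempotent G x (r + 1) *ᵥ sphereSum G v r

theorem ladderVec_succ_apply (r : ℕ) (z : X) :
    ladderVec G x v (r + 1) z = if G.dist x z = r + 1 then sphereSum G v r z else 0 :=
  dualIdempotent_mulVec_apply x (r + 1) _ z

theorem ladderVec_apply_of_dist_ne {r : ℕ} {z : X} (hz : G.dist x z ≠ r) :
    ladderVec G x v r z = 0 := by
  rcases r with _ | r
  · rfl
  · rw [ladderVec_succ_apply, if_neg hz]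

theorem ladderVec_self (r : ℕ) : ladderVec G x v r x = 0 := by
  rcases r with _ | r
  · rfl
  · rw [ladderVec_succ_apply, G.dist_self, if_neg (by lia)]

theorem cAdj_mulVec_ladderVec_apply_eq_zero {r : ℕ} {z : X}
    (hz : r = 0 ∨ G.dist x z + 1 < r ∨ r + 1 < G.dist x z) :
    (cAdj G *ᵥ ladderVec G x v r) z = 0 := by
  rcases hz with rfl | hz
  · simp [ladderVec]
  · exact cAdj_mulVec_apply_eq_zero (fun y => ladderVec_apply_of_dist_ne) hz

theorem IsLocalVector.ladderVec_one (hv : IsLocalVector G x v) (hG : G.Connected) :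
    ladderVec G x v 1 = v := by
  ext y
  rw [ladderVec_succ_apply, sphereSum_zero hG]
  exact ite_eq_left_iff.2 fun hy => (hv.support y hy).symm

namespace HasSphereRatio

variable {q : ℕ → ℝ}

theorem sphereSum_eq (hq : HasSphereRatio G x v q) (hv : IsLocalVector G x v) (hG : G.Connected)
    (r : ℕ) : sphereSum G v r = ladderVec G x v (r + 1) + (-1 - q r : ℂ) • ladderVec G x v r +
      (q (r - 1) : ℂ) • ladderVec G x v (r - 1) := by
  ext z
  simp only [Pi.add_apply, Pi.smul_apply, smul_eq_mul]
  rcases hz : G.dist x z with _ | i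
  · obtain rfl := hG.dist_eq_zero_iff.1 hz
    simp [hv.sphereSum_self, ladderVec_self]
  obtain rfl | rfl | rfl | hfar : i = r ∨ r = i + 1 ∨ r = i + 2 ∨ (i + 2 < r ∨ r < i) := by lia
  · simp [ladderVec_succ_apply, hz, ladderVec_apply_of_dist_ne,
      ladderVec_apply_of_dist_ne (show G.dist x z ≠ i - 1 by lia)]
  · simp [ladderVec_succ_apply, hz, ladderVec_apply_of_dist_ne, hv.sphereSum_succ_apply hG hq hz]
  · simp [ladderVec_succ_apply, hz, hq z i hz]
  · rw [hv.sphereSum_apply_eq_zero hG (by lia), ladderVec_apply_of_dist_ne (by lia),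
      ladderVec_apply_of_dist_ne (by lia), ladderVec_apply_of_dist_ne (by lia)]
    simp

theorem cAdj_mulVec_sphereSum (hq : HasSphereRatio G x v q) (hv : IsLocalVector G x v)
    (hG : G.Connected) (r : ℕ) : cAdj G *ᵥ sphereSum G v r = cAdj G *ᵥ ladderVec G x v (r + 1) +
      (-1 - q r : ℂ) • cAdj G *ᵥ ladderVec G x v r +
        (q (r - 1) : ℂ) • cAdj G *ᵥ ladderVec G x v (r - 1) := by
  rw [hq.sphereSum_eq hv hG]
  simp only [mulVec_add, mulVec_smul]

theorem cAdj_mulVec_ladderVec_apply_up (hq : HasSphereRatio G x v q) (hv : IsLocalVector G x v)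
    (h : HasIntersectionArray G c a b) {r : ℕ} {z : X} (hz : G.dist x z = r + 2) :
    (cAdj G *ᵥ ladderVec G x v (r + 1)) z = c (r + 1) * ladderVec G x v (r + 2) z := by
  have hA := congrFun (hq.cAdj_mulVec_sphereSum hv h.connected r) z
  have hzero : (cAdj G *ᵥ ladderVec G x v r) z = 0 :=
    cAdj_mulVec_ladderVec_apply_eq_zero (by lia)
  have hzero' : (cAdj G *ᵥ ladderVec G x v (r - 1)) z = 0 :=
    cAdj_mulVec_ladderVec_apply_eq_zero (by lia)
  rw [h.cAdj_mulVec_sphereSum_apply hv (by lia),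
    hv.sphereSum_apply_eq_zero h.connected (by lia)] at hA
  simp only [Pi.add_apply, Pi.smul_apply, smul_eq_mul, hzero, hzero'] at hA
  rw [ladderVec_succ_apply, if_pos hz]
  linear_combination -hA

theorem cAdj_mulVec_ladderVec_apply_flat (hq : HasSphereRatio G x v q) (hv : IsLocalVector G x v)
    (h : HasIntersectionArray G c a b) {r : ℕ} {z : X} (hz : G.dist x z = r + 1) :
    (cAdj G *ᵥ ladderVec G x v (r + 1)) z =
      flatCoeff c a q (r + 1) * ladderVec G x v (r + 1) z := by
  have hA := congrFun (hq.cAdj_mulVec_sphereSum hv h.connected r) z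
  have hup : (cAdj G *ᵥ ladderVec G x v r) z = c r * ladderVec G x v (r + 1) z := by
    rcases r with _ | r
    · simp [ladderVec, h.c_zero]
    · exact hq.cAdj_mulVec_ladderVec_apply_up hv h hz
  have hzero : (cAdj G *ᵥ ladderVec G x v (r - 1)) z = 0 :=
    cAdj_mulVec_ladderVec_apply_eq_zero (by lia)
  rw [h.cAdj_mulVec_sphereSum_apply hv (by lia), hv.sphereSum_succ_apply h.connected hq hz] at hA
  simp only [Pi.add_apply, Pi.smul_apply, smul_eq_mul, hup, hzero] at hA
  rw [ladderVec_succ_apply, if_pos hz] at hA ⊢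
  simp only [flatCoeff, Nat.add_sub_cancel]
  push_cast
  linear_combination -hA

theorem cAdj_mulVec_ladderVec_apply_down (hq : HasSphereRatio G x v q) (hv : IsLocalVector G x v)
    (h : HasIntersectionArray G c a b) {r : ℕ} {z : X} (hz : G.dist x z = r + 1) :
    (cAdj G *ᵥ ladderVec G x v (r + 2)) z =
      downCoeff c a b q (r + 2) * ladderVec G x v (r + 1) z := by
  have hA := congrFun (hq.cAdj_mulVec_sphereSum hv h.connected (r + 1)) z
  have hup : (cAdj G *ᵥ ladderVec G x v r) z = c r * ladderVec G x v (r + 1) z := by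
    rcases r with _ | r
    · simp [ladderVec, h.c_zero]
    · exact hq.cAdj_mulVec_ladderVec_apply_up hv h hz
  rw [h.cAdj_mulVec_sphereSum_succ] at hA
  simp only [Pi.add_apply, Pi.smul_apply, smul_eq_mul, Nat.add_sub_cancel, hup,
    hq.cAdj_mulVec_ladderVec_apply_flat hv h hz, hv.sphereSum_succ_apply h.connected hq hz,
    hq z r hz] at hA
  rw [ladderVec_succ_apply, if_pos hz] at hA ⊢
  simp only [downCoeff, Nat.add_sub_cancel, show r + 2 - 1 = r + 1 from rfl]
  push_cast
  linear_combination -hA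

theorem cAdj_mulVec_ladderVec (hq : HasSphereRatio G x v q) (hv : IsLocalVector G x v)
    (h : HasIntersectionArray G c a b) (r : ℕ) : cAdj G *ᵥ ladderVec G x v (r + 1) =
      (c (r + 1) : ℂ) • ladderVec G x v (r + 2) +
        (flatCoeff c a q (r + 1) : ℂ) • ladderVec G x v (r + 1) +
          (downCoeff c a b q (r + 1) : ℂ) • ladderVec G x v r := by
  ext z
  simp only [Pi.add_apply, Pi.smul_apply, smul_eq_mul]
  obtain hz | hz | hz | hz : G.dist x z = r + 2 ∨ G.dist x z = r + 1 ∨ G.dist x z = r ∨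
    (G.dist x z + 1 < r + 1 ∨ r + 1 + 1 < G.dist x z) := by lia
  · rw [hq.cAdj_mulVec_ladderVec_apply_up hv h hz, ladderVec_apply_of_dist_ne (r := r) (by lia),
      ladderVec_apply_of_dist_ne (r := r + 1) (by lia), mul_zero, mul_zero, add_zero, add_zero]
  · rw [hq.cAdj_mulVec_ladderVec_apply_flat hv h hz, ladderVec_apply_of_dist_ne (r := r) (by lia),
      ladderVec_apply_of_dist_ne (r := r + 2) (by lia), mul_zero, mul_zero, add_zero, zero_add]
  · rw [ladderVec_apply_of_dist_ne (r := r + 1) (by lia),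
      ladderVec_apply_of_dist_ne (r := r + 2) (by lia), mul_zero, mul_zero, add_zero, zero_add]
    rcases r with _ | r
    · obtain rfl := h.connected.dist_eq_zero_iff.1 hz
      have hA := h.cAdj_mulVec_sphereSum_zero (v := v)
      rw [sphereSum_zero h.connected] at hA
      simp [ladderVec_self, hv.ladderVec_one h.connected, hA, hv.sphereSum_self, hv.support]
    · exact hq.cAdj_mulVec_ladderVec_apply_down hv h hz
  · rw [cAdj_mulVec_ladderVec_apply_eq_zero (.inr hz),
      ladderVec_apply_of_dist_ne (r := r) (by lia),
      ladderVec_apply_of_dist_ne (r := r + 1) (by lia),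
      ladderVec_apply_of_dist_ne (r := r + 2) (by lia), mul_zero, mul_zero, mul_zero, add_zero,
      add_zero]

end HasSphereRatio

end Ladder

/-! ### Ladders of tight graphs -/

section TightLadder

variable {X : Type*} [Fintype X] {G : SimpleGraph X} {x : X} {v : X → ℂ} {c a b : ℕ → ℕ}

/-- Nonzero vectors `w 1, …, w (d - 1)`, with `w r` supported on the sphere of radius `r` around
`x`, on which the adjacency matrix acts tridiagonally. The off-diagonal coefficients leading out of
this range are zero. -/
structure IsLadder (G : SimpleGraph X) (x : X) (d : ℕ) (up flat down : ℕ → ℝ) (w : ℕ → X → ℂ) :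
    Prop where
  support : ∀ r y, G.dist x y ≠ r → w r y = 0
  zero : w 0 = 0
  one_ne_zero : w 1 ≠ 0
  eq_zero : ∀ r, d ≤ r → w r = 0
  cAdj_mulVec : ∀ r, cAdj G *ᵥ w (r + 1) =
    (up (r + 1) : ℂ) • w (r + 2) + (flat (r + 1) : ℂ) • w (r + 1) + (down (r + 1) : ℂ) • w r
  up_zero : up 0 = 0
  up_ne_zero : ∀ r, 1 ≤ r → r < d → up r ≠ 0
  down_self : down d = 0
  down_ne_zero : ∀ r, 2 ≤ r → r < d → down r ≠ 0

theorem IsLocalVector.isLadder [DecidableEq X] (hv : IsLocalVector G x v)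
    (h : HasIntersectionArray G c a b) (hv₀ : v ≠ 0) {u q : ℕ → ℝ} (hu : cDistMatrix G u *ᵥ v = 0)
    (hgap : ∀ i < G.diam, u i ≠ u (i + 1))
    (hq : ∀ i, i + 1 < G.diam → q (i + 1) * (u (i + 1) - u (i + 2)) = u i - u (i + 1))
    (hdown_self : downCoeff c a b q G.diam = 0)
    (hdown : ∀ r, 2 ≤ r → r < G.diam → downCoeff c a b q r ≠ 0) :
    IsLadder G x G.diam (fun r => c r) (flatCoeff c a q) (downCoeff c a b q)
      (ladderVec G x v) where
  support _ _ := ladderVec_apply_of_dist_ne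
  zero := rfl
  one_ne_zero := by rwa [hv.ladderVec_one h.connected]
  eq_zero r hr := by
    ext z
    rcases r with _ | r
    · rfl
    rw [ladderVec_succ_apply]
    refine ite_eq_right_iff.2 fun hz => ?_
    have hle := dist_le_diam_of_connected h.connected x z
    exact hv.sphereSum_apply_eq_zero_of_dist_eq_diam h.connected hu hgap hz (by lia)
  cAdj_mulVec r := by
    push_cast
    exact (hv.hasSphereRatio h.connected hu hgap hq).cAdj_mulVec_ladderVec hv h r
  up_zero := by simp [h.c_zero]
  up_ne_zero r h1 hr := Nat.cast_ne_zero.2 (h.c_pos h1 hr.le).ne'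
  down_self := hdown_self
  down_ne_zero := hdown

/-- The sphere ratios of the local vectors in the kernel of `cDistMatrix G (leastSeq α β)`. -/
noncomputable def leastRatio (α β : ℝ) (r : ℕ) : ℝ := -(β - α * r) / (1 + α * (r - 1))

theorem leastRatio_succ (α β : ℝ) (r : ℕ) :
    leastRatio α β (r + 1) = -(β - α * (r + 1)) / (1 + α * r) := by
  rw [leastRatio, Nat.cast_add_one, add_sub_cancel_right]

theorem leastSeq_one (α β : ℝ) : leastSeq α β 1 = -1 / β := by
  simp [leastSeq]

theorem leastSeq_two (α β : ℝ) : leastSeq α β 2 = (1 + α) / (β - α) / β := by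
  rw [leastSeq, leastSeq_one, Nat.cast_one]
  ring

theorem HasIntersectionArray.exists_forall_localAction_ne_zero [DecidableEq X]
    (h : HasIntersectionArray G c a b) (hb : 1 < b 0) (x : X) : ∃ v, IsLocalVector G x v ∧
      ∀ u : ℕ → ℝ, u 0 ≠ u 1 → u 0 ≠ u 2 → localAction G x u v ≠ 0 := by
  classical
  rw [← h.card_neighborFinset x, one_lt_card] at hb
  obtain ⟨y, hy, z, hz, hyz⟩ := hb
  rw [mem_neighborFinset, ← dist_eq_one_iff_adj] at hy hz
  refine ⟨Pi.single y 1 - Pi.single z 1, ⟨fun t ht => ?_, by simp⟩, fun u h₁ h₂ hzero => ?_⟩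
  · rw [Pi.sub_apply, Pi.single_eq_of_ne (by rintro rfl; exact ht hy),
      Pi.single_eq_of_ne (by rintro rfl; exact ht hz), sub_zero]
  · have hval := congrFun hzero y
    rw [localAction_apply, if_pos hy, mulVec_sub] at hval
    have heq : u 0 = u (G.dist y z) := by simpa [sub_eq_zero] using hval
    have hpos := h.connected.pos_dist_of_ne hyz
    have htri := h.connected.dist_triangle (u := y) (v := x) (w := z)
    rw [G.dist_comm (u := y) (v := x), hy, hz] at htri
    rcases (by lia : G.dist y z = 1 ∨ G.dist y z = 2) with hd | hd
    · exact h₁ (hd ▸ heq)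
    · exact h₂ (hd ▸ heq)

namespace HasUnitBaseArray

variable {D : ℕ} {α β : ℝ}

theorem b_zero_ne_zero (h : HasUnitBaseArray G D α β c a b) : b 0 ≠ 0 :=
  (h.b_pos (by have := h.three_le; have := h.diam_eq; lia)).ne'

theorem one_add_alpha_mul_pos (h : HasUnitBaseArray G D α β c a b) (i : ℕ) : 0 < 1 + α * i := by
  have := h.alpha_nonneg
  positivity

theorem secondSeq_succ_lt (h : HasUnitBaseArray G D α β c a b) (i : ℕ) :
    secondSeq D α β (i + 1) < secondSeq D α β i := by
  have hβ := h.beta_pos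
  have hD : 0 ≤ α * (D - 1) := mul_nonneg h.alpha_nonneg (by linarith [h.three_le_cast])
  simp only [secondSeq]
  push_cast
  linarith

theorem leastSeq_ne_zero (h : HasUnitBaseArray G D α β c a b) {i : ℕ} (hi : i ≤ D) :
    leastSeq α β i ≠ 0 := by
  induction i with
  | zero => exact one_ne_zero
  | succ i ih =>
    exact mul_ne_zero (div_ne_zero (neg_ne_zero.2 (h.one_add_alpha_mul_pos i).ne')
      (h.beta_sub_pos hi).ne') (ih (by lia))

theorem mul_leastSeq_sub_succ (h : HasUnitBaseArray G D α β c a b) {i : ℕ} (hi : i < D) :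
    (β - α * i) * (leastSeq α β i - leastSeq α β (i + 1)) = (β + 1) * leastSeq α β i := by
  linear_combination -h.sub_mul_leastSeq_succ hi

theorem leastSeq_ne_succ (h : HasUnitBaseArray G D α β c a b) {i : ℕ} (hi : i < D) :
    leastSeq α β i ≠ leastSeq α β (i + 1) := fun heq => by
  have hmul := h.mul_leastSeq_sub_succ hi
  rw [heq, sub_self, mul_zero, ← heq] at hmul
  exact mul_ne_zero (by linarith [h.beta_pos]) (h.leastSeq_ne_zero hi.le) hmul.symm

theorem leastRatio_succ_mul (h : HasUnitBaseArray G D α β c a b) {i : ℕ} (hi : i + 1 < D) :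
    leastRatio α β (i + 1) * (leastSeq α β (i + 1) - leastSeq α β (i + 2)) =
      leastSeq α β i - leastSeq α β (i + 1) := by
  have hα := (h.one_add_alpha_mul_pos i).ne'
  have hmul := h.mul_leastSeq_sub_succ hi
  have hstep := h.sub_mul_leastSeq_succ (show i < D by lia)
  have hgap := h.mul_leastSeq_sub_succ (show i < D by lia)
  apply mul_left_cancel₀ (h.beta_sub_pos (show i < D by lia)).ne'
  rw [hgap, leastRatio_succ]
  push_cast at hmul
  field_simp
  linear_combination -(β - α * i) * hmul - (β + 1) * hstep

theorem localAction_ne_zero_or [DecidableEq X] (h : HasUnitBaseArray G D α β c a b)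
    (hv : IsLocalVector G x v) (hv₀ : v ≠ 0) :
    localAction G x (leastSeq α β) v ≠ 0 ∨ localAction G x (secondSeq D α β) v ≠ 0 := by
  by_contra! hzero
  obtain ⟨hl, hs⟩ := hzero
  rw [hv.localAction_eq h.connected] at hl hs
  have hcomb : ((leastSeq α β 0 - 2 * leastSeq α β 1 + leastSeq α β 2 : ℝ) : ℂ) • v = 0 := by
    have hκ : (secondSeq D α β 1 - secondSeq D α β 2 : ℂ) ≠ 0 :=
      sub_ne_zero.2 (by exact_mod_cast (h.secondSeq_succ_lt 1).ne')
    have hlin : (secondSeq D α β 0 - secondSeq D α β 2 : ℂ) =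
        2 * (secondSeq D α β 1 - secondSeq D α β 2) := by
      simp only [secondSeq]
      push_cast
      ring
    rw [hlin, mul_comm, mul_smul, ← smul_add, smul_eq_zero_iff_right hκ] at hs
    rw [← hl, eq_neg_of_add_eq_zero_right hs]
    push_cast
    module
  have hα := h.alpha_nonneg
  have hβ := h.beta_pos
  have hβ₁ : 0 < β - α := by simpa using h.beta_sub_pos (i := 1) (by have := h.three_le; lia)
  have hpos : 0 < leastSeq α β 0 - 2 * leastSeq α β 1 + leastSeq α β 2 := by
    have h₂ : 0 < leastSeq α β 2 := by rw [leastSeq_two]; positivity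
    have h₁ : leastSeq α β 1 < 0 := by rw [leastSeq_one, neg_div]; simpa using hβ
    have h₀ : leastSeq α β 0 = 1 := rfl
    linarith
  exact hv₀ ((smul_eq_zero.1 hcomb).resolve_left (by exact_mod_cast hpos.ne'))

end HasUnitBaseArray

/-- `G` has the intersection array of a tight graph with classical parameters `(D, 1, α, β)`: the
tightness condition amounts to `β = 1 + α * (D - 1)`. -/
abbrev HasTightArray (G : SimpleGraph X) (D : ℕ) (α : ℝ) (c a b : ℕ → ℕ) : Prop :=
  HasUnitBaseArray G D α (1 + α * (D - 1)) c a b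

namespace HasTightArray

variable {D : ℕ} {α : ℝ}

theorem arrayStep_secondSeq_mul_leastSeq (h : HasTightArray G D α c a b) :
    b 0 * arrayStep c a b (fun i => secondSeq D α (1 + α * (D - 1)) i *
      leastSeq α (1 + α * (D - 1)) i) 1 =
        arrayStep c a b (secondSeq D α (1 + α * (D - 1))) 1 *
          arrayStep c a b (leastSeq α (1 + α * (D - 1))) 1 := by
  have hD := h.three_le
  have hβ : 1 + α * ((D : ℝ) - 1) ≠ 0 := h.beta_pos.ne'
  have hβ₁ : 1 + α * ((D : ℝ) - 1) - α ≠ 0 := by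
    simpa using (h.beta_sub_pos (i := 1) (by lia)).ne'
  simp only [h.arrayStep_eq _ (show 1 ≤ D by lia), h.b_eq 0 (by lia), Nat.sub_self,
    Nat.reduceAdd, leastSeq_one, leastSeq_two, secondSeq, show leastSeq _ _ 0 = 1 from rfl]
  push_cast
  field_simp
  ring

theorem a_eq_two_mul (h : HasTightArray G D α c a b) {i : ℕ} (hi : i ≤ D) :
    (a i : ℝ) = 2 * α * i * (D - i) := by
  rw [h.a_eq hi]
  ring

theorem flatCoeff_one (h : HasTightArray G D α c a b) (q : ℕ → ℝ) :
    flatCoeff c a q 1 = -1 - q 1 := by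
  simp [flatCoeff, h.a_zero, h.c_zero, h.c_eq 1 (by have := h.three_le; lia)]

theorem flatCoeff_leastRatio_one (h : HasTightArray G D α c a b) :
    flatCoeff c a (leastRatio α (1 + α * (D - 1))) 1 = α * (D - 2) := by
  rw [h.flatCoeff_one, leastRatio_succ]
  push_cast
  ring

theorem downCoeff_one (h : HasTightArray G D α c a b) {r : ℕ} (h₂ : 2 ≤ r) (hr : r ≤ D) :
    downCoeff c a b (fun _ => 1) r = (D - r) * (1 + α * (D - 1 - r)) := by
  obtain ⟨r, rfl⟩ := Nat.exists_eq_add_of_le' h₂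
  simp only [downCoeff, flatCoeff, Nat.add_sub_cancel, show r + 2 - 1 = r + 1 from rfl]
  rw [h.c_eq _ hr, h.c_eq (r + 1) (by lia), h.c_eq r (by lia), h.a_eq_two_mul (by lia),
    h.a_eq_two_mul (by lia), h.b_eq r (by lia)]
  push_cast
  ring

theorem downCoeff_leastRatio (h : HasTightArray G D α c a b) {r : ℕ} (h₂ : 2 ≤ r) (hr : r ≤ D) :
    downCoeff c a b (leastRatio α (1 + α * (D - 1))) r =
      (D - r) * (1 + α * (D - r)) * (1 + α * (r - 1)) / (1 + α * (r - 2)) := by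
  obtain ⟨r, rfl⟩ := Nat.exists_eq_add_of_le' h₂
  have h₀ := h.one_add_alpha_mul_pos r
  have hc : c r * leastRatio α (1 + α * (D - 1)) r = -r * (1 + α * (D - 1) - α * r) := by
    rcases r with _ | r
    · simp [h.c_zero]
    have h₁ := h.one_add_alpha_mul_pos r
    rw [h.c_eq _ (by lia), leastRatio_succ]
    push_cast
    rw [add_sub_cancel_right, mul_assoc, mul_div_cancel₀ _ h₁.ne']
    ring
  rw [eq_div_iff (by push_cast; rw [add_sub_cancel_right]; exact h₀.ne')]
  have hq : (1 + α * r) * leastRatio α (1 + α * (D - 1)) (r + 1) =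
      -(1 + α * (D - 1) - α * (r + 1)) := by
    rw [leastRatio_succ, mul_div_cancel₀ _ h₀.ne']
  simp only [downCoeff, flatCoeff, Nat.add_sub_cancel, show r + 2 - 1 = r + 1 from rfl]
  generalize leastRatio α (1 + α * (D - 1)) (r + 1) = q₁ at hq
  generalize leastRatio α (1 + α * (D - 1)) r = q₀ at hc
  rw [h.c_eq _ hr, h.c_eq (r + 1) (by lia), h.a_eq_two_mul (by lia), h.a_eq_two_mul (by lia),
    h.b_eq r (by lia)]
  rw [h.c_eq r (by lia)] at hc ⊢
  push_cast
  linear_combination (1 + α * r) * q₁ * hc + (-2 * α * (r + 1) * (D - r - 1) +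
    (r + 2) * (1 + α * (r + 1)) + 2 * α * r * (D - r) + r * (1 + α * (r - 1)) -
      r * (1 + α * (D - 1) - α * r) - (r + 1) * (2 * (1 + α * r) + (1 + α * r) * q₁ -
        (1 + α * (D - 1) - α * (r + 1)))) * hq

theorem downCoeff_two_ne (h : HasTightArray G D α c a b) (hα : 0 < α) :
    downCoeff c a b (fun _ => 1) 2 ≠ downCoeff c a b (leastRatio α (1 + α * (D - 1))) 2 := by
  have hD := h.three_le_cast
  have hpos : 0 < α * (D - 2) * (2 + α * (D - 2)) := by
    have : (0 : ℝ) < D - 2 := by linarith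
    positivity
  rw [h.downCoeff_one le_rfl (by have := h.three_le; lia),
    h.downCoeff_leastRatio le_rfl (by have := h.three_le; lia)]
  push_cast
  intro heq
  ring_nf at heq
  nlinarith

variable [DecidableEq X]

theorem cDistMatrix_secondSeq_mulVec_localAction (h : HasTightArray G D α c a b)
    (hv : IsLocalVector G x v) : cDistMatrix G (secondSeq D α (1 + α * (D - 1))) *ᵥ
      localAction G x (leastSeq α (1 + α * (D - 1))) v = 0 :=
  hv.cDistMatrix_mulVec_localAction_eq_zero h.1 h.b_zero_ne_zero h.isStandardSequence_secondSeq
    h.isStandardSequence_leastSeq h.arrayStep_secondSeq_mul_leastSeq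

theorem cDistMatrix_leastSeq_mulVec_localAction (h : HasTightArray G D α c a b)
    (hv : IsLocalVector G x v) : cDistMatrix G (leastSeq α (1 + α * (D - 1))) *ᵥ
      localAction G x (secondSeq D α (1 + α * (D - 1))) v = 0 :=
  hv.cDistMatrix_mulVec_localAction_eq_zero h.1 h.b_zero_ne_zero h.isStandardSequence_leastSeq
    h.isStandardSequence_secondSeq
    (by simpa only [mul_comm] using h.arrayStep_secondSeq_mul_leastSeq)

theorem isLadder_second (h : HasTightArray G D α c a b) (hv : IsLocalVector G x v)
    (hne : localAction G x (leastSeq α (1 + α * (D - 1))) v ≠ 0) :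
    IsLadder G x D (fun r => c r) (flatCoeff c a fun _ => 1) (downCoeff c a b fun _ => 1)
      (ladderVec G x (localAction G x (leastSeq α (1 + α * (D - 1))) v)) := by
  obtain rfl := h.diam_eq
  refine (hv.isLocalVector_localAction h.1 _).isLadder h.1 hne
    (h.cDistMatrix_secondSeq_mulVec_localAction hv) (fun i _ => (h.secondSeq_succ_lt i).ne')
    (fun i _ => ?_) ?_ fun r h₂ hr => ?_
  · simp only [secondSeq]
    push_cast
    ring
  · rw [h.downCoeff_one (by have := h.three_le; lia) le_rfl, sub_self, zero_mul]
  · have hβ := h.beta_sub_pos hr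
    have hD : (0 : ℝ) < G.diam - r := sub_pos.2 (by exact_mod_cast hr)
    rw [h.downCoeff_one h₂ hr.le]
    exact mul_ne_zero hD.ne' (by linarith)

theorem isLadder_least (h : HasTightArray G D α c a b) (hv : IsLocalVector G x v)
    (hne : localAction G x (secondSeq D α (1 + α * (D - 1))) v ≠ 0) :
    IsLadder G x D (fun r => c r) (flatCoeff c a (leastRatio α (1 + α * (D - 1))))
      (downCoeff c a b (leastRatio α (1 + α * (D - 1))))
      (ladderVec G x (localAction G x (secondSeq D α (1 + α * (D - 1))) v)) := by
  obtain rfl := h.diam_eq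
  refine (hv.isLocalVector_localAction h.1 _).isLadder h.1 hne
    (h.cDistMatrix_leastSeq_mulVec_localAction hv) (fun i => h.leastSeq_ne_succ)
    (fun i => h.leastRatio_succ_mul) ?_ fun r h₂ hr => ?_
  · rw [h.downCoeff_leastRatio (by have := h.three_le; lia) le_rfl, sub_self, zero_mul, zero_mul,
      zero_div]
  · have hα := h.alpha_nonneg
    have hD : (0 : ℝ) < G.diam - r := sub_pos.2 (by exact_mod_cast hr)
    have h₂' : (0 : ℝ) ≤ r - 2 := sub_nonneg.2 (by exact_mod_cast h₂)
    have h₁ : (0 : ℝ) ≤ r - 1 := by linarith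
    rw [h.downCoeff_leastRatio h₂ hr.le]
    positivity

theorem exists_localAction_ne_zero (h : HasTightArray G D α c a b) (hα : 0 < α) (x : X) :
    ∃ v, IsLocalVector G x v ∧ localAction G x (leastSeq α (1 + α * (D - 1))) v ≠ 0 ∧
      localAction G x (secondSeq D α (1 + α * (D - 1))) v ≠ 0 := by
  have hD := h.three_le_cast
  have hαD : 0 < α * (D - 2) := mul_pos hα (by linarith)
  have hb : 1 < b 0 := by
    suffices (1 : ℝ) < b 0 by exact_mod_cast this
    rw [h.b_eq 0 (by lia), Nat.cast_zero]
    nlinarith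
  obtain ⟨v, hv, hne⟩ := h.1.exists_forall_localAction_ne_zero hb x
  have hsecond := h.secondSeq_succ_lt
  refine ⟨v, hv, hne _ (h.leastSeq_ne_succ (by have := h.three_le; lia)) ?_,
    hne _ (hsecond 0).ne' ((hsecond 1).trans (hsecond 0)).ne'⟩
  have : 0 < 1 + α * ((D : ℝ) - 1) - α := by linarith
  rw [leastSeq_two, div_div, ne_comm, leastSeq, Ne, div_eq_one_iff_eq (by nlinarith)]
  nlinarith

end HasTightArray

end TightLadder

/-! ### Modules spanned by ladders -/

section SphereAction

variable {X : Type*} [Fintype X] {H : SimpleGraph X} {x : X} {r : ℕ} {f : X → ℂ}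

theorem le_vertexEcc_or_eq_zero (hf : ∀ y, H.dist x y ≠ r → f y = 0) :
    r ≤ vertexEcc H x ∨ f = 0 := by
  refine or_iff_not_imp_right.2 fun hne => ?_
  obtain ⟨y, hy⟩ := Function.ne_iff.1 hne
  rw [← not_ne_iff.1 fun hr => hy (hf y hr)]
  exact le_sup (f := H.dist x) (mem_univ y)

variable [DecidableEq X]

theorem dualIdempotent_mulVec_of_support (hf : ∀ y, H.dist x y ≠ r → f y = 0) (i : ℕ) :
    dualIdempotent H x i *ᵥ f = if i = r then f else 0 := by
  ext y
  rw [dualIdempotent_mulVec_apply]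
  split_ifs with hy hi hi
  · rfl
  · exact hf y (hy ▸ hi)
  · exact (hf y (hi ▸ hy)).symm
  · rfl

theorem dualIdempotent_eq_zero_of_vertexEcc_lt {i : ℕ} (hi : vertexEcc H x < i) :
    dualIdempotent H x i = 0 := by
  rw [dualIdempotent, diagonal_eq_zero]
  exact funext fun y =>
    if_neg ((le_sup (f := H.dist x) (mem_univ y)).trans_lt hi).ne

theorem sum_mul_dualIdempotent_mulVec (hf : ∀ y, H.dist x y ≠ r → f y = 0) (s : Finset ℕ)
    (B : ℕ → Matrix X X ℂ) :
    (∑ i ∈ s, B i * dualIdempotent H x i) *ᵥ f = if r ∈ s then B r *ᵥ f else 0 := by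
  rw [sum_mulVec, ← sum_ite_eq' s r fun i => B i *ᵥ f]
  refine sum_congr rfl fun i _ => ?_
  rw [← mulVec_mulVec, dualIdempotent_mulVec_of_support hf]
  split_ifs <;> simp

theorem lowering_mulVec (hf : ∀ y, H.dist x y ≠ r + 1 → f y = 0) :
    lowering H x *ᵥ f = dualIdempotent H x r *ᵥ (cAdj H *ᵥ f) := by
  rw [lowering, sum_mul_dualIdempotent_mulVec hf]
  rcases le_vertexEcc_or_eq_zero hf with hr | rfl
  · rw [if_pos (mem_Icc.2 ⟨by lia, hr⟩), Nat.add_sub_cancel, mulVec_mulVec]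
  · simp

theorem flat_mulVec (hf : ∀ y, H.dist x y ≠ r → f y = 0) :
    flat H x *ᵥ f = dualIdempotent H x r *ᵥ (cAdj H *ᵥ f) := by
  rw [flat, sum_mul_dualIdempotent_mulVec hf]
  rcases le_vertexEcc_or_eq_zero hf with hr | rfl
  · rw [if_pos (mem_range.2 (by lia)), mulVec_mulVec]
  · simp

theorem raising_mulVec (hf : ∀ y, H.dist x y ≠ r → f y = 0) :
    raising H x *ᵥ f = dualIdempotent H x (r + 1) *ᵥ (cAdj H *ᵥ f) := by
  rw [raising, sum_mul_dualIdempotent_mulVec hf]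
  split_ifs with hr
  · rw [mulVec_mulVec]
  · rw [dualIdempotent_eq_zero_of_vertexEcc_lt (by rw [mem_range] at hr; lia), zero_mulVec]

end SphereAction

section TerwilligerAlgebra

variable {X : Type*} [Fintype X] [DecidableEq X] {H : SimpleGraph X} {x : X}
  {T : Subalgebra ℂ (Matrix X X ℂ)} {W : Submodule ℂ (X → ℂ)}

theorem cAdj_mem_terwilligerAlgebra : cAdj H ∈ terwilligerAlgebra H x :=
  Algebra.subset_adjoin (Set.mem_insert _ _)

theorem dualIdempotent_mem_terwilligerAlgebra (i : ℕ) :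
    dualIdempotent H x i ∈ terwilligerAlgebra H x :=
  Algebra.subset_adjoin (Set.mem_insert_of_mem _ (Set.mem_range_self i))

theorem dualIdempotent_mulVec_mem (hW : IsTModule (terwilligerAlgebra H x) W) (i : ℕ) {f : X → ℂ}
    (hf : f ∈ W) : dualIdempotent H x i *ᵥ f ∈ W :=
  hW _ (dualIdempotent_mem_terwilligerAlgebra i) f hf

theorem cAdj_mulVec_mem (hW : IsTModule (terwilligerAlgebra H x) W) {f : X → ℂ} (hf : f ∈ W) :
    cAdj H *ᵥ f ∈ W :=
  hW _ cAdj_mem_terwilligerAlgebra f hf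

theorem areTIsomorphic_range_of_ker_eq {M : Type*} [AddCommGroup M] [Module ℂ M]
    {φ φ' : M →ₗ[ℂ] X → ℂ} (hker : LinearMap.ker φ = LinearMap.ker φ')
    (hT : ∀ B ∈ T, ∃ g : M → M, ∀ ξ, B *ᵥ φ ξ = φ (g ξ) ∧ B *ᵥ φ' ξ = φ' (g ξ)) :
    AreTIsomorphic T (LinearMap.range φ) (LinearMap.range φ') := by
  let σ := φ.quotKerEquivRange.symm ≪≫ₗ Submodule.quotEquivOfEq _ _ hker ≪≫ₗ φ'.quotKerEquivRange
  have hσ (ξ : M) : σ ⟨φ ξ, LinearMap.mem_range_self φ ξ⟩ = φ' ξ := by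
    have hsymm : φ.quotKerEquivRange.symm ⟨φ ξ, LinearMap.mem_range_self φ ξ⟩ =
        Submodule.Quotient.mk ξ := (LinearEquiv.symm_apply_eq _).2 rfl
    simp only [σ, LinearEquiv.trans_apply, hsymm]
    rfl
  refine ⟨σ, fun B hB ⟨_, ξ, rfl⟩ ⟨u, hu⟩ hBu => ?_⟩
  obtain ⟨g, hg⟩ := hT B hB
  obtain rfl : u = φ (g ξ) := hBu.trans (hg ξ).1
  rw [hσ, hσ, (hg ξ).2]

end TerwilligerAlgebra

section LadderModule

open Finsupp (linearCombination)

variable {X : Type*} [Fintype X] {H : SimpleGraph X} {x : X} {d : ℕ} {up flat down : ℕ → ℝ}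
  {w w' : ℕ → X → ℂ}

theorem mulVec_linearCombination_of_forall {B : Matrix X X ℂ} {g : ℕ → ℕ →₀ ℂ}
    (hB : ∀ r, B *ᵥ w r = linearCombination ℂ w (g r)) (ξ : ℕ →₀ ℂ) :
    B *ᵥ linearCombination ℂ w ξ = linearCombination ℂ w (linearCombination ℂ g ξ) := by
  suffices B.mulVecLin ∘ₗ linearCombination ℂ w = linearCombination ℂ w ∘ₗ linearCombination ℂ g
    from LinearMap.congr_fun this ξ
  ext1 r
  refine LinearMap.ext_ring ?_
  simpa using hB r

namespace IsLadder

theorem linearCombination_apply (hw : IsLadder H x d up flat down w) (ξ : ℕ →₀ ℂ) (y : X) :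
    linearCombination ℂ w ξ y = ξ (H.dist x y) * w (H.dist x y) y := by
  rw [Finsupp.linearCombination_apply, Finsupp.sum, Finset.sum_apply,
    Finset.sum_eq_single (H.dist x y) (fun r _ hr => by simp [hw.support r y hr.symm])]
  · rfl
  · intro hy
    simp [Finsupp.notMem_support_iff.1 hy]

theorem linearCombination_eq_zero_iff_smul (hw : IsLadder H x d up flat down w) {ξ : ℕ →₀ ℂ} :
    linearCombination ℂ w ξ = 0 ↔ ∀ r, ξ r • w r = 0 := by
  refine ⟨fun hξ r => ?_, fun hξ => ?_⟩
  · ext y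
    by_cases hy : H.dist x y = r
    · subst hy
      exact (hw.linearCombination_apply ξ y).symm.trans (congrFun hξ y)
    · simp [hw.support r y hy]
  · ext y
    exact (hw.linearCombination_apply ξ y).trans (congrFun (hξ _) y)

variable [DecidableEq X]

theorem dualIdempotent_mulVec (hw : IsLadder H x d up flat down w) (i r : ℕ) :
    dualIdempotent H x i *ᵥ w r = if i = r then w r else 0 :=
  dualIdempotent_mulVec_of_support (hw.support r) i

theorem dualIdempotent_mulVec_linearCombination (hw : IsLadder H x d up flat down w) (i : ℕ)
    (ξ : ℕ →₀ ℂ) : dualIdempotent H x i *ᵥ linearCombination ℂ w ξ = ξ i • w i := by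
  ext y
  rw [dualIdempotent_mulVec_apply, hw.linearCombination_apply]
  split_ifs with hy
  · rw [hy, Pi.smul_apply, smul_eq_mul]
  · simp [hw.support i y hy]

theorem dualIdempotent_mulVec_cAdj_mulVec (hw : IsLadder H x d up flat down w) (r : ℕ) :
    dualIdempotent H x r *ᵥ (cAdj H *ᵥ w (r + 1)) = (down (r + 1) : ℂ) • w r := by
  simp [hw.cAdj_mulVec, mulVec_add, mulVec_smul, hw.dualIdempotent_mulVec]

theorem dualIdempotent_self_mulVec_cAdj_mulVec (hw : IsLadder H x d up flat down w) (r : ℕ) :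
    dualIdempotent H x (r + 1) *ᵥ (cAdj H *ᵥ w (r + 1)) = (flat (r + 1) : ℂ) • w (r + 1) := by
  simp [hw.cAdj_mulVec, mulVec_add, mulVec_smul, hw.dualIdempotent_mulVec]

theorem dualIdempotent_succ_mulVec_cAdj_mulVec (hw : IsLadder H x d up flat down w) (r : ℕ) :
    dualIdempotent H x (r + 1) *ᵥ (cAdj H *ᵥ w r) = (up r : ℂ) • w (r + 1) := by
  rcases r with _ | r
  · simp [hw.zero, hw.up_zero]
  · simp [hw.cAdj_mulVec, mulVec_add, mulVec_smul, hw.dualIdempotent_mulVec, add_assoc]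

omit [DecidableEq X] in
theorem ne_zero (hw : IsLadder H x d up flat down w) {r : ℕ} (h₁ : 1 ≤ r) (hr : r < d) :
    w r ≠ 0 := by
  classical
  induction r, h₁ using Nat.le_induction with
  | base => exact hw.one_ne_zero
  | succ r h₁ ih =>
    intro hzero
    have hdown := hw.dualIdempotent_mulVec_cAdj_mulVec r
    rw [hzero, mulVec_zero, mulVec_zero, eq_comm, smul_eq_zero_iff_left (ih (by lia)),
      Complex.ofReal_eq_zero] at hdown
    exact hw.down_ne_zero (r + 1) (by lia) hr hdown

omit [DecidableEq X] in
theorem smul_eq_zero_iff (hw : IsLadder H x d up flat down w) {t : ℂ} {r : ℕ} :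
    t • w r = 0 ↔ 1 ≤ r → r < d → t = 0 := by
  by_cases hr : 1 ≤ r ∧ r < d
  · rw [smul_eq_zero_iff_left (hw.ne_zero hr.1 hr.2)]
    simp [hr]
  · suffices w r = 0 by simp only [this, smul_zero, true_iff]; tauto
    rcases Nat.eq_zero_or_pos r with rfl | h₁
    · exact hw.zero
    · exact hw.eq_zero r (by lia)

theorem exists_mulVec_linearCombination {B : Matrix X X ℂ} (hB : B ∈ terwilligerAlgebra H x)
    (d : ℕ) (up flat down : ℕ → ℝ) :
    ∃ g : (ℕ →₀ ℂ) →ₗ[ℂ] (ℕ →₀ ℂ), ∀ w, IsLadder H x d up flat down w →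
      ∀ ξ, B *ᵥ linearCombination ℂ w ξ = linearCombination ℂ w (g ξ) := by
  induction hB using Algebra.adjoin_induction with
  | mem B hB =>
    rcases hB with rfl | ⟨i, rfl⟩
    · refine ⟨linearCombination ℂ fun r => match r with
        | 0 => 0
        | r + 1 => (up (r + 1) : ℂ) • Finsupp.single (r + 2) 1 +
            (flat (r + 1) : ℂ) • Finsupp.single (r + 1) 1 +
            (down (r + 1) : ℂ) • Finsupp.single r 1,
        fun w hw => mulVec_linearCombination_of_forall fun r => ?_⟩
      rcases r with _ | r
      · simp [hw.zero]
      · simp [hw.cAdj_mulVec]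
    · refine ⟨linearCombination ℂ fun r => if i = r then Finsupp.single r 1 else 0,
        fun w hw => mulVec_linearCombination_of_forall fun r => ?_⟩
      rw [hw.dualIdempotent_mulVec]
      split_ifs <;> simp
  | algebraMap t =>
    exact ⟨t • LinearMap.id, fun w _ ξ => by simp [Algebra.algebraMap_eq_smul_one, smul_mulVec]⟩
  | add B C _ _ hB hC =>
    obtain ⟨g, hg⟩ := hB
    obtain ⟨k, hk⟩ := hC
    exact ⟨g + k, fun w hw ξ => by simp [add_mulVec, hg w hw, hk w hw]⟩
  | mul B C _ _ hB hC =>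
    obtain ⟨g, hg⟩ := hB
    obtain ⟨k, hk⟩ := hC
    exact ⟨g ∘ₗ k, fun w hw ξ => by simp [← mulVec_mulVec, hg w hw, hk w hw]⟩

theorem isTModule_span (hw : IsLadder H x d up flat down w) :
    IsTModule (terwilligerAlgebra H x) (Submodule.span ℂ (Set.range w)) := by
  rw [← Finsupp.range_linearCombination]
  rintro B hB _ ⟨ξ, rfl⟩
  obtain ⟨g, hg⟩ := exists_mulVec_linearCombination hB d up flat down
  exact ⟨g ξ, (hg w hw ξ).symm⟩

theorem areTIsomorphic_span (hw : IsLadder H x d up flat down w)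
    (hw' : IsLadder H x d up flat down w') :
    AreTIsomorphic (terwilligerAlgebra H x) (Submodule.span ℂ (Set.range w))
      (Submodule.span ℂ (Set.range w')) := by
  rw [← Finsupp.range_linearCombination, ← Finsupp.range_linearCombination]
  refine areTIsomorphic_range_of_ker_eq ?_ fun B hB => ?_
  · ext ξ
    rw [LinearMap.mem_ker, LinearMap.mem_ker, hw.linearCombination_eq_zero_iff_smul,
      hw'.linearCombination_eq_zero_iff_smul]
    exact forall_congr' fun r => hw.smul_eq_zero_iff.trans hw'.smul_eq_zero_iff.symm
  · obtain ⟨g, hg⟩ := exists_mulVec_linearCombination hB d up flat down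
    exact ⟨g, fun ξ => ⟨hg w hw ξ, hg w' hw' ξ⟩⟩

theorem span_le_of_one_mem (hw : IsLadder H x d up flat down w) {W : Submodule ℂ (X → ℂ)}
    (hW : IsTModule (terwilligerAlgebra H x) W) (hmem : w 1 ∈ W) :
    Submodule.span ℂ (Set.range w) ≤ W := by
  suffices ∀ r, w (r + 1) ∈ W by
    rw [Submodule.span_le, Set.range_subset_iff]
    rintro (_ | r)
    · rw [hw.zero]
      exact W.zero_mem
    · exact this r
  intro r
  induction r with
  | zero => exact hmem
  | succ r ih =>
    by_cases hr : r + 1 < d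
    · have hup : (up (r + 1) : ℂ) ≠ 0 := by exact_mod_cast hw.up_ne_zero _ (by lia) hr
      rw [← W.smul_mem_iff hup, ← hw.dualIdempotent_succ_mulVec_cAdj_mulVec]
      exact dualIdempotent_mulVec_mem hW _ (cAdj_mulVec_mem hW ih)
    · rw [hw.eq_zero _ (by lia)]
      exact W.zero_mem

theorem one_mem_of_mem (hw : IsLadder H x d up flat down w) {W : Submodule ℂ (X → ℂ)}
    (hW : IsTModule (terwilligerAlgebra H x) W) {r : ℕ} (h₁ : 1 ≤ r) (hr : r < d)
    (hmem : w r ∈ W) : w 1 ∈ W := by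
  induction r, h₁ using Nat.le_induction with
  | base => exact hmem
  | succ r h₁ ih =>
    have hdown : (down (r + 1) : ℂ) ≠ 0 := by exact_mod_cast hw.down_ne_zero _ (by lia) hr
    refine ih (by lia) ?_
    rw [← W.smul_mem_iff hdown, ← hw.dualIdempotent_mulVec_cAdj_mulVec]
    exact dualIdempotent_mulVec_mem hW _ (cAdj_mulVec_mem hW hmem)

theorem isIrreducibleTModule_span (hw : IsLadder H x d up flat down w) :
    IsIrreducibleTModule (terwilligerAlgebra H x) (Submodule.span ℂ (Set.range w)) := by
  refine ⟨hw.isTModule_span, fun hbot => hw.one_ne_zero ?_, fun W hle hW => ?_⟩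
  · rw [← Submodule.mem_bot ℂ, ← hbot]
    exact Submodule.subset_span (Set.mem_range_self 1)
  · refine or_iff_not_imp_left.2 fun hbot => hle.antisymm ?_
    obtain ⟨f, hf, hf₀⟩ := W.ne_bot_iff.1 hbot
    obtain ⟨ξ, rfl⟩ := (Finsupp.mem_span_range_iff_exists_finsupp.1 (hle hf))
    obtain ⟨r, hr⟩ := not_forall.1 (mt hw.linearCombination_eq_zero_iff_smul.2 hf₀)
    obtain ⟨h₁, hd, hξ⟩ : 1 ≤ r ∧ r < d ∧ ξ r ≠ 0 := by
      simpa [hw.smul_eq_zero_iff] using hr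
    refine hw.span_le_of_one_mem hW (hw.one_mem_of_mem hW h₁ hd ?_)
    rw [← W.smul_mem_iff hξ, ← hw.dualIdempotent_mulVec_linearCombination]
    exact dualIdempotent_mulVec_mem hW r hf

theorem dualComponent_span (hw : IsLadder H x d up flat down w) (i : ℕ) :
    dualComponent H x i (Submodule.span ℂ (Set.range w)) = ℂ ∙ w i := by
  rw [dualComponent, Submodule.map_span]
  refine le_antisymm (Submodule.span_le.2 ?_) (Submodule.span_mono ?_)
  · rintro _ ⟨_, ⟨r, rfl⟩, rfl⟩
    rw [mulVecLin_apply, hw.dualIdempotent_mulVec]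
    split_ifs with hi
    · exact hi ▸ Submodule.mem_span_singleton_self _
    · exact zero_mem _
  · rw [Set.singleton_subset_iff]
    exact ⟨w i, Set.mem_range_self i, by simp [hw.dualIdempotent_mulVec]⟩

theorem endpoint_span (hw : IsLadder H x d up flat down w) :
    endpoint H x (Submodule.span ℂ (Set.range w)) = 1 := by
  simp only [endpoint, hw.dualComponent_span, Ne, Submodule.span_singleton_eq_bot]
  refine le_antisymm (Nat.sInf_le hw.one_ne_zero) (Nat.one_le_iff_ne_zero.2 fun hzero => ?_)
  have hmem := Nat.sInf_mem (s := {i | w i ≠ 0}) ⟨1, hw.one_ne_zero⟩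
  rw [hzero] at hmem
  exact hmem hw.zero

theorem hasLocalEigenvalue_span (hw : IsLadder H x d up flat down w) :
    HasLocalEigenvalue H x (Submodule.span ℂ (Set.range w)) (flat 1) := by
  refine ⟨fun i => ?_, fun f hf => ?_⟩
  · rw [hw.dualComponent_span]
    exact (finrank_span_le_card _).trans (by simp)
  · rw [hw.endpoint_span, hw.dualComponent_span, Submodule.mem_span_singleton] at hf
    obtain ⟨t, rfl⟩ := hf
    rw [mulVec_smul, flat_mulVec (hw.support 1), hw.dualIdempotent_self_mulVec_cAdj_mulVec,
      smul_comm]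

end IsLadder

end LadderModule

/-! ### Uniform structures and the graph without flat edges -/

section UniformStructure

variable {ε : ℕ} {U : ℕ → ℕ → ℂ}

theorem sum_Icc_mul_of_isParameterMatrix (hU : IsParameterMatrix ε U) {j : ℕ} (hj : j + 3 ≤ ε)
    (φ : ℕ → ℂ) : ∑ k ∈ Icc 1 ε, U (j + 2) k * φ k =
      U (j + 2) (j + 1) * φ (j + 1) + φ (j + 2) + U (j + 2) (j + 3) * φ (j + 3) := by
  have hmem : j + 2 ∈ Icc 1 ε := mem_Icc.2 ⟨by lia, by lia⟩
  rw [← sum_subset (s₁ := {j + 1, j + 2, j + 3}) (fun k hk => ?_) fun k hk hk' => ?_]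
  · rw [sum_insert (by simp), sum_insert (by simp), sum_singleton, hU.diagonal _ hmem]
    ring
  · simp only [mem_insert, mem_singleton] at hk
    exact mem_Icc.2 ⟨by lia, by lia⟩
  · simp only [mem_insert, mem_singleton] at hk'
    rw [hU.tridiagonal _ hmem k hk (by lia), zero_mul]

theorem eq_zero_of_isParameterMatrix (hU : IsParameterMatrix ε U) {φ : ℕ → ℂ} (h₁ : φ 1 = 0)
    (hε : φ ε = 0) (h : ∀ j, j + 3 ≤ ε → U (j + 2) (j + 1) * φ (j + 1) + φ (j + 2) +
      U (j + 2) (j + 3) * φ (j + 3) = 0) {r : ℕ} (h₂ : 2 ≤ r) (hr : r < ε) : φ r = 0 := by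
  have hker : (Matrix.of fun i j : Icc 2 (ε - 1) => U i j) *ᵥ (fun j => φ j) = 0 := by
    ext ⟨i, hi⟩
    rw [mem_Icc] at hi
    obtain ⟨j, rfl⟩ := Nat.exists_eq_add_of_le' hi.1
    rw [mulVec, dotProduct, Pi.zero_apply, ← h j (by lia),
      ← sum_Icc_mul_of_isParameterMatrix hU (by lia)]
    simp only [of_apply]
    rw [sum_coe_sort (Icc 2 (ε - 1)) fun k => U (j + 2) k * φ k]
    refine sum_subset (Icc_subset_Icc (by lia) (by lia)) fun k hk hk' => ?_
    rw [mem_Icc] at hk hk'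
    rcases (by lia : k = 1 ∨ k = ε) with rfl | rfl
    · rw [h₁, mul_zero]
    · rw [hε, mul_zero]
  have hdet := hU.nonsingular 2 (ε - 1) (by lia) (by lia) (by lia)
  exact congrFun (eq_zero_of_mulVec_eq_zero hdet hker) ⟨r, mem_Icc.2 ⟨h₂, by lia⟩⟩

namespace IsLadder

variable {X : Type*} [Fintype X] [DecidableEq X] {H : SimpleGraph X} {x : X} {d : ℕ}
  {up flat down up' flat' down' : ℕ → ℝ} {w w' : ℕ → X → ℂ}

theorem lowering_mulVec (hw : IsLadder H x d up flat down w) (r : ℕ) :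
    lowering H x *ᵥ w (r + 1) = (down (r + 1) : ℂ) • w r := by
  rw [DistanceRegular.lowering_mulVec (hw.support _), hw.dualIdempotent_mulVec_cAdj_mulVec]

theorem raising_mulVec (hw : IsLadder H x d up flat down w) (r : ℕ) :
    raising H x *ᵥ w r = (up r : ℂ) • w (r + 1) := by
  rw [DistanceRegular.raising_mulVec (hw.support _), hw.dualIdempotent_succ_mulVec_cAdj_mulVec]

theorem uniform_relation (hw : IsLadder H x d up flat down w) (hd : vertexEcc H x = d)
    {f : ℕ → ℂ} (hU : IsUniformStructure H x U f) {j : ℕ} (hj : j + 3 ≤ d) :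
    U (j + 2) (j + 1) * (up j * down (j + 1)) + up (j + 1) * down (j + 2) +
      U (j + 2) (j + 3) * (up (j + 2) * down (j + 3)) = f (j + 2) := by
  have hrel := congrArg (· *ᵥ w (j + 2)) (hU.2 (j + 2) (mem_Icc.2 ⟨by lia, by lia⟩))
  simp only [← mulVec_mulVec, hw.dualIdempotent_mulVec, if_true, add_mulVec, smul_mulVec, pow_two,
    hw.lowering_mulVec, hw.raising_mulVec, mulVec_smul, eMinus, ePlus, hd,
    if_pos (show j + 2 < d by lia), if_pos (Nat.le_add_left 2 j), Nat.add_succ_sub_one] at hrel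
  have hdown : (down (j + 2) : ℂ) ≠ 0 := by
    exact_mod_cast hw.down_ne_zero _ (by lia) (by lia)
  have hne := hw.ne_zero (r := j + 1) (by lia) (by lia)
  apply mul_left_cancel₀ hdown
  apply smul_left_injective ℂ hne
  linear_combination (norm := module) hrel

theorem up_mul_down_eq_of_isUniformStructure (hw : IsLadder H x d up flat down w)
    (hw' : IsLadder H x d up' flat' down' w') (hd : vertexEcc H x = d) {f : ℕ → ℂ}
    (hU : IsUniformStructure H x U f) {r : ℕ} (h₁ : 1 ≤ r) (hr : r + 1 < d) :
    up r * down (r + 1) = up' r * down' (r + 1) := by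
  have hzero := eq_zero_of_isParameterMatrix (r := r + 1) (hd ▸ hU.1)
    (φ := fun r => ((up (r - 1) * down r - up' (r - 1) * down' r : ℝ) : ℂ))
    (by simp [hw.up_zero, hw'.up_zero]) (by simp [hw.down_self, hw'.down_self]) (fun j hj => ?_)
    (by lia) hr
  · exact sub_eq_zero.1 (by exact_mod_cast hzero)
  · have hrel := hw.uniform_relation hd hU hj
    have hrel' := hw'.uniform_relation hd hU hj
    simp only [Nat.add_succ_sub_one]
    push_cast
    linear_combination hrel - hrel'

theorem up_mul_down_eq_of_areTIsomorphic (hw : IsLadder H x d up flat down w)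
    (hw' : IsLadder H x d up' flat' down' w')
    (hiso : AreTIsomorphic (terwilligerAlgebra H x) (Submodule.span ℂ (Set.range w))
      (Submodule.span ℂ (Set.range w'))) : up 1 * down 2 = up' 1 * down' 2 := by
  obtain ⟨σ, hσ⟩ := hiso
  let B := dualIdempotent H x 1 * (cAdj H * (dualIdempotent H x 2 * cAdj H))
  have hB : B ∈ terwilligerAlgebra H x :=
    mul_mem (dualIdempotent_mem_terwilligerAlgebra 1) (mul_mem cAdj_mem_terwilligerAlgebra
      (mul_mem (dualIdempotent_mem_terwilligerAlgebra 2) cAdj_mem_terwilligerAlgebra))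
  have hBw {up flat down : ℕ → ℝ} {w : ℕ → X → ℂ} (hw : IsLadder H x d up flat down w) :
      B *ᵥ w 1 = (up 1 * down 2 : ℂ) • w 1 := by
    simp only [B, ← mulVec_mulVec]
    rw [hw.dualIdempotent_succ_mulVec_cAdj_mulVec, mulVec_smul, mulVec_smul,
      hw.dualIdempotent_mulVec_cAdj_mulVec, smul_smul]
  let w₁ : Submodule.span ℂ (Set.range w) := ⟨w 1, Submodule.subset_span (Set.mem_range_self 1)⟩
  obtain ⟨t, ht⟩ : ∃ t : ℂ, (σ w₁ : X → ℂ) = t • w' 1 := by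
    obtain ⟨ξ, hξ⟩ := Finsupp.mem_span_range_iff_exists_finsupp.1 (σ w₁).2
    refine ⟨ξ 1, (hσ _ (dualIdempotent_mem_terwilligerAlgebra 1) w₁ w₁ ?_).trans ?_⟩
    · simp [w₁, hw.dualIdempotent_mulVec]
    · rw [← hξ, ← hw'.dualIdempotent_mulVec_linearCombination]
      rfl
  have hσB := hσ B hB w₁ ((up 1 * down 2 : ℂ) • w₁) (hBw hw).symm
  rw [map_smul, Submodule.coe_smul, ht, mulVec_smul, hBw hw', smul_comm t] at hσB
  have hne : t • w' 1 ≠ 0 := by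
    rw [← ht, Ne, Submodule.coe_eq_zero, map_eq_zero_iff σ σ.injective]
    exact fun hzero => hw.one_ne_zero (congrArg Subtype.val hzero)
  exact_mod_cast smul_left_injective ℂ hne hσB

end IsLadder

end UniformStructure

section FlatFree

variable {X : Type*} {G : SimpleGraph X} {x : X}

theorem exists_walk_flatFree_length_eq_dist (hG : G.Connected) (x y : X) :
    ∃ q : (flatFree G x).Walk x y, q.length = G.dist x y := by
  induction hn : G.dist x y generalizing y with
  | zero =>
    obtain rfl := hG.dist_eq_zero_iff.1 hn
    exact ⟨Walk.nil, rfl⟩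
  | succ n ih =>
    obtain ⟨z, hz, hzy⟩ := exists_dist_add_dist_eq hG (show n ≤ G.dist x y by lia)
    obtain ⟨q, hq⟩ := ih z hz
    have hadj : (flatFree G x).Adj z y := ⟨dist_eq_one_iff_adj.1 (by lia), by lia⟩
    exact ⟨q.concat hadj, by rw [Walk.length_concat, hq]⟩

theorem dist_flatFree (hG : G.Connected) (x y : X) : (flatFree G x).dist x y = G.dist x y := by
  obtain ⟨q, hq⟩ := exists_walk_flatFree_length_eq_dist hG x y
  exact le_antisymm (hq ▸ dist_le q) (q.reachable.dist_anti fun _ _ h => h.1)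

variable [Fintype X]

theorem vertexEcc_flatFree (hG : G.Connected) (x : X) :
    vertexEcc (flatFree G x) x = vertexEcc G x := by
  simp only [vertexEcc, dist_flatFree hG]

theorem cAdj_flatFree_mulVec [DecidableEq X] {r : ℕ} {f : X → ℂ}
    (hf : ∀ y, G.dist x y ≠ r → f y = 0) : cAdj (flatFree G x) *ᵥ f =
      cAdj G *ᵥ f - dualIdempotent G x r *ᵥ (cAdj G *ᵥ f) := by
  ext y
  rw [Pi.sub_apply, dualIdempotent_mulVec_apply, cAdj, cAdj, adjMatrix_mulVec_apply,
    adjMatrix_mulVec_apply]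
  classical
  simp only [neighborFinset_eq_filter, sum_filter]
  split_ifs with hy
  · rw [sub_self]
    refine sum_eq_zero fun z _ => ite_eq_right_iff.2 fun hz => hf z fun hzr => ?_
    exact hz.2 (hy.trans hzr.symm)
  · rw [sub_zero]
    refine sum_congr rfl fun z _ => ?_
    by_cases hz : G.dist x z = r
    · simp [flatFree, hz, hy]
    · simp [hf z hz]

theorem IsLadder.flatFree {d : ℕ} {up flat down : ℕ → ℝ} {w : ℕ → X → ℂ}
    (hw : IsLadder G x d up flat down w) (hG : G.Connected) :
    IsLadder (flatFree G x) x d up 0 down w :=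
  { hw with
    support := fun r y hy => hw.support r y (dist_flatFree hG x y ▸ hy)
    cAdj_mulVec := fun r => by
      classical
      rw [cAdj_flatFree_mulVec (hw.support _), hw.dualIdempotent_self_mulVec_cAdj_mulVec,
        hw.cAdj_mulVec, Pi.zero_apply, Complex.ofReal_zero]
      module }

end FlatFree

/-! ### Modules of endpoint one -/

section EndpointOne

variable {X : Type*} [Fintype X] [DecidableEq X] {G : SimpleGraph X} {x : X}
  {W : Submodule ℂ (X → ℂ)}

theorem dualIdempotent_mulVec_eq_zero_of_lt_endpoint {i : ℕ} (hi : i < endpoint G x W) {f : X → ℂ}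
    (hf : f ∈ W) : dualIdempotent G x i *ᵥ f = 0 := by
  have hbot : dualComponent G x i W = ⊥ := not_ne_iff.1 (Nat.notMem_of_lt_sInf hi)
  exact (Submodule.eq_bot_iff _).1 hbot _ ⟨f, hf, rfl⟩

theorem exists_dualIdempotent_mulVec_ne_zero (hW : endpoint G x W ≠ 0) :
    ∃ f ∈ W, dualIdempotent G x (endpoint G x W) *ᵥ f ≠ 0 := by
  have hne : dualComponent G x (endpoint G x W) W ≠ ⊥ :=
    Nat.sInf_mem (Nat.nonempty_of_pos_sInf (Nat.pos_of_ne_zero hW))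
  obtain ⟨_, ⟨f, hf, rfl⟩, hf₀⟩ := (Submodule.ne_bot_iff _).1 hne
  exact ⟨f, hf, hf₀⟩

theorem exists_isLocalVector_of_endpoint_eq_one (hW : IsTModule (terwilligerAlgebra G x) W)
    (hend : endpoint G x W = 1) : ∃ v ∈ W, IsLocalVector G x v ∧ v ≠ 0 := by
  obtain ⟨f, hf, hf₀⟩ := exists_dualIdempotent_mulVec_ne_zero (by rw [hend]; exact one_ne_zero)
  rw [hend] at hf₀
  have hv := dualIdempotent_mulVec_mem hW 1 hf
  have hsupport (y : X) (hy : G.dist x y ≠ 1) : (dualIdempotent G x 1 *ᵥ f) y = 0 := by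
    rw [dualIdempotent_mulVec_apply, if_neg hy]
  refine ⟨_, hv, ⟨hsupport, ?_⟩, hf₀⟩
  have hlt : 0 < endpoint G x W := by lia
  have hzero := congrFun (dualIdempotent_mulVec_eq_zero_of_lt_endpoint hlt
    (cAdj_mulVec_mem hW hv)) x
  rw [dualIdempotent_mulVec_apply, if_pos SimpleGraph.dist_self, cAdj,
    adjMatrix_mulVec_apply] at hzero
  classical
  rw [← sum_subset (subset_univ (G.neighborFinset x)) fun y _ hy => hsupport y ?_]
  · exact hzero
  · rwa [Ne, dist_eq_one_iff_adj, ← mem_neighborFinset]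

theorem localAction_mem (hW : IsTModule (terwilligerAlgebra G x) W) (hG : G.Connected)
    {v : X → ℂ} (hv : IsLocalVector G x v) (hvW : v ∈ W) (u : ℕ → ℝ) :
    localAction G x u v ∈ W := by
  rw [hv.localAction_eq hG]
  exact W.add_mem (W.smul_mem _ hvW)
    (W.smul_mem _ (dualIdempotent_mulVec_mem hW 1 (cAdj_mulVec_mem hW hvW)))

theorem IsLadder.eq_span_of_one_mem {d : ℕ} {up flat down : ℕ → ℝ} {w : ℕ → X → ℂ}
    (hw : IsLadder G x d up flat down w) (hW : IsIrreducibleTModule (terwilligerAlgebra G x) W)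
    (hmem : w 1 ∈ W) : W = Submodule.span ℂ (Set.range w) :=
  ((hW.2.2 _ (hw.span_le_of_one_mem hW.1 hmem) hw.isTModule_span).resolve_left
    hw.isIrreducibleTModule_span.2.1).symm

namespace HasTightArray

variable {D : ℕ} {α : ℝ} {c a b : ℕ → ℕ}

theorem tildeValue_secondEigenvalue (h : HasTightArray G D α c a b) {p : ℕ → ℕ → ℕ → ℕ}
    (hb : b 1 = p 1 1 2) :
    tildeValue p G.secondEigenvalue = flatCoeff c a (fun _ => 1) 1 := by
  have hD := h.three_le
  have hb₁ : (b 1 : ℝ) ≠ 0 := Nat.cast_ne_zero.2 (h.b_pos (by have := h.diam_eq; lia)).ne'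
  have hθ : 1 + theta D α (1 + α * (D - 1)) 1 = b 1 := by
    rw [h.b_eq 1 (by lia), theta, Nat.cast_one, add_sub_cancel]
  rw [h.flatCoeff_one, tildeValue, ← hb, h.secondEigenvalue_eq, hθ, div_self hb₁]

theorem tildeValue_leastEigenvalue (h : HasTightArray G D α c a b) {p : ℕ → ℕ → ℕ → ℕ}
    (hb : b 1 = p 1 1 2) : tildeValue p G.leastEigenvalue =
      flatCoeff c a (leastRatio α (1 + α * (D - 1))) 1 := by
  have hD := h.three_le
  have hne : (1 : ℝ) + -D ≠ 0 := by linarith [h.three_le_cast]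
  rw [h.flatCoeff_leastRatio_one, tildeValue, ← hb, h.leastEigenvalue_eq, h.b_eq 1 (by lia)]
  field_simp
  push_cast
  ring

omit [DecidableEq X] in
theorem c_one_mul_downCoeff_two_ne (h : HasTightArray G D α c a b) (hα : 0 < α) :
    c 1 * downCoeff c a b (fun _ => 1) 2 ≠
      c 1 * downCoeff c a b (leastRatio α (1 + α * (D - 1))) 2 :=
  (mul_right_injective₀ (Nat.cast_ne_zero.2 (h.c_pos le_rfl
    (by have := h.three_le; have := h.diam_eq; lia)).ne')).ne (h.downCoeff_two_ne hα)

omit [DecidableEq X] in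
theorem exists_isLadder (h : HasTightArray G D α c a b) (hα : 0 < α) (x : X) :
    (∃ w, IsLadder G x D (fun r => c r) (flatCoeff c a fun _ => 1)
      (downCoeff c a b fun _ => 1) w) ∧
    ∃ w, IsLadder G x D (fun r => c r) (flatCoeff c a (leastRatio α (1 + α * (D - 1))))
      (downCoeff c a b (leastRatio α (1 + α * (D - 1)))) w := by
  classical
  obtain ⟨v, hv, hsecond, hleast⟩ := h.exists_localAction_ne_zero hα x
  exact ⟨⟨_, h.isLadder_second hv hsecond⟩, ⟨_, h.isLadder_least hv hleast⟩⟩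

theorem exists_isLadder_and_eq_span (h : HasTightArray G D α c a b)
    (hW : IsIrreducibleTModule (terwilligerAlgebra G x) W) (hend : endpoint G x W = 1) :
    (∃ w, IsLadder G x D (fun r => c r) (flatCoeff c a fun _ => 1)
      (downCoeff c a b fun _ => 1) w ∧ W = Submodule.span ℂ (Set.range w)) ∨
    ∃ w, IsLadder G x D (fun r => c r) (flatCoeff c a (leastRatio α (1 + α * (D - 1))))
      (downCoeff c a b (leastRatio α (1 + α * (D - 1)))) w ∧
        W = Submodule.span ℂ (Set.range w) := by
  obtain ⟨v, hvW, hv, hv₀⟩ := exists_isLocalVector_of_endpoint_eq_one hW.1 hend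
  have hmem (u : ℕ → ℝ) : ladderVec G x (localAction G x u v) 1 ∈ W := by
    rw [(hv.isLocalVector_localAction h.1 u).ladderVec_one h.connected]
    exact localAction_mem hW.1 h.connected hv hvW u
  refine (h.localAction_ne_zero_or hv hv₀).imp (fun hne => ?_) fun hne => ?_
  · have hw := h.isLadder_second hv hne
    exact ⟨_, hw, hw.eq_span_of_one_mem hW (hmem _)⟩
  · have hw := h.isLadder_least hv hne
    exact ⟨_, hw, hw.eq_span_of_one_mem hW (hmem _)⟩

end HasTightArray

end EndpointOne

end DistanceRegular

theorem theorem9p2 {X : Type*} [Fintype X] [DecidableEq X] (G : SimpleGraph X)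
    (p : ℕ → ℕ → ℕ → ℕ) (hG : G.IsDistanceRegularWith p) (hbip : ¬ G.IsBipartite)
    (D : ℕ) (hD : 3 ≤ D) (α β : ℝ) (hcl : G.HasClassicalParameters p D 1 α β)
    (htight : G.IsTight p) (x : X) :
    ¬ G.SupportsUniformStructure x ∧
    ∃ W₁ W_D : Submodule ℂ (X → ℂ),
      (SimpleGraph.IsIrreducibleTModule (G.terwilligerAlgebra x) W₁ ∧ G.endpoint x W₁ = 1 ∧
        G.HasLocalEigenvalue x W₁ (SimpleGraph.tildeValue p G.secondEigenvalue)) ∧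
      (SimpleGraph.IsIrreducibleTModule (G.terwilligerAlgebra x) W_D ∧ G.endpoint x W_D = 1 ∧
        G.HasLocalEigenvalue x W_D (SimpleGraph.tildeValue p G.leastEigenvalue)) ∧
      (∀ W : Submodule ℂ (X → ℂ),
        SimpleGraph.IsIrreducibleTModule (G.terwilligerAlgebra x) W → G.endpoint x W = 1 →
          SimpleGraph.AreTIsomorphic (G.terwilligerAlgebra x) W W₁ ∨
          SimpleGraph.AreTIsomorphic (G.terwilligerAlgebra x) W W_D) ∧
      ¬ SimpleGraph.AreTIsomorphic ((G.flatFree x).terwilligerAlgebra x) W₁ W_D := by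
  obtain ⟨c, a, b, h, hb₀, ha₁, hb₁⟩ := DistanceRegular.exists_hasUnitBaseArray hG hD hcl
  obtain rfl := h.beta_eq_of_tight (by rw [hb₀, ha₁, hb₁]; exact htight)
  replace h : DistanceRegular.HasTightArray G D α c a b := h
  have hα := h.alpha_pos rfl hbip
  have hne := h.c_one_mul_downCoeff_two_ne hα
  obtain ⟨⟨w₁, hw₁⟩, w_D, hw_D⟩ := h.exists_isLadder hα x
  have hf₁ := hw₁.flatFree h.connected
  have hf_D := hw_D.flatFree h.connected
  have hecc : SimpleGraph.vertexEcc (G.flatFree x) x = D := by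
    rw [DistanceRegular.vertexEcc_flatFree h.connected, h.vertexEcc_eq_diam, h.diam_eq]
  rw [h.tildeValue_secondEigenvalue hb₁, h.tildeValue_leastEigenvalue hb₁]
  refine ⟨fun ⟨U, f, hU⟩ => hne (hf₁.up_mul_down_eq_of_isUniformStructure hf_D hecc hU le_rfl hD),
    _, _, ⟨hw₁.isIrreducibleTModule_span, hw₁.endpoint_span, hw₁.hasLocalEigenvalue_span⟩,
    ⟨hw_D.isIrreducibleTModule_span, hw_D.endpoint_span, hw_D.hasLocalEigenvalue_span⟩,
    fun W hW hend => ?_, fun hiso => hne (hf₁.up_mul_down_eq_of_areTIsomorphic hf_D hiso)⟩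
  rcases h.exists_isLadder_and_eq_span hW hend with ⟨w, hw, rfl⟩ | ⟨w, hw, rfl⟩
  · exact .inl (hw.areTIsomorphic_span hw₁)
  · exact .inr (hw.areTIsomorphic_span hw_D)
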